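/- Let $k,\ell\ge 2$ be standard natural numbers. Over $\mathsf{RCA}_0$ the principles $\mathsf{Baire\text{-}DRT}^k_\ell$, $\mathsf{ODRT}^k_\ell$ and $\mathsf{CDRT}^k_\ell$ defined below are equivalent; that is, in every (not necessarily $\omega$-) model $(M,S)$ of $\mathsf{RCA}_0$, either all three hold or all three fail (by the completeness theorem this says that $\mathsf{RCA}_0$ proves the equivalences). Here $\mathsf{RCA}_0$ is the system of second order arithmetic that consists of the basic axioms for $0,1,+,\cdot,<$, induction for $\Sigma^0_1$ formulas and comprehension for $\Delta^0_1$ formulas (with parameters). The following definitions are made in $\mathsf{RCA}_0$; $\omega$ denotes the set of all numbers, functions are sets of pairs, and finite strings are coded by numbers in the usual way. A function $f$ from $\omega$, or a finite string, with values in $k=\{0,\dots,k-1\}$ or in $\omega$ is *ordered* if, whenever $f(n)=i$ and $j<i$, there is $m<n$ with $f(m)=j$. Let $(\omega)^k$ and $(\omega)^\omega$ be the sets of ordered surjective functions $\omega\to k$ and $\omega\to\omega$, and let $(\omega)^k_{\mathrm{fin}}$ be the set of ordered strings over $k$ in which every $i<k$ appears. For $x\in(\omega)^k$ and $i<k$,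 $\mu^x(i)$ is the least $n$ with $x(n)=i$, and $x\upharpoonright m$ is the initial segment of $x$ of length $m$. For $p\in(\omega)^\omega$, $(p)^k$ is the set of $x\in(\omega)^k$ such that $p(n)=p(m)$ implies $x(n)=x(m)$. A code for an open set in $(\omega)^k$ is a set $O\subseteq\omega\times(\omega)^k_{\mathrm{fin}}$; $x\in(\omega)^k$ is in it, written $x\in O$, if some $\langle n,\sigma\rangle\in O$ has $\sigma\prec x$ (that is, $\sigma$ is an initial segment of $x$). It is dense if for every $\tau\in(\omega)^k_{\mathrm{fin}}$ there is $\langle n,\sigma\rangle\in O$ such that $\sigma$ and $\tau$ are comparable as strings (one of them is an initial segment of the other). A sequence $\{D_n\}_{n<\omega}$ of open sets is coded by a set $D\subseteq\omega\times\omega\times(\omega)^k_{\mathrm{fin}}$, where $D_i=\{\langle n,\sigma\rangle:\langle i,n,\sigma\rangle\in D\}$. A Baire $\ell$-coloring of $(\omega)^k$ is a sequence $\{D_n\}_{n<\omega}$ of dense open sets together with open sets $O_0,\dots,O_{\ell-1}$ whose union is dense. 1. $\mathsf{Baire\text{-}DRT}^k_\ell$: for every Baire $\ell$-coloring $\{O_i\}_{i<\ell}$,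 $\{D_n\}_{n<\omega}$ of $(\omega)^k$ there are $p\in(\omega)^\omega$ and $i<\ell$ such that $x\in O_i\cap\bigcap_n D_n$ for all $x\in(p)^k$. 2. $\mathsf{ODRT}^k_\ell$: for all open sets $O_0,\dots,O_{\ell-1}$ with $(\omega)^k=\bigcup_{i<\ell}O_i$ there are $p\in(\omega)^\omega$ and $i<\ell$ such that $x\in O_i$ for all $x\in(p)^k$. 3. $\mathsf{CDRT}^k_\ell$: for all sets $C_0,\dots,C_{\ell-1}$ with $(\omega)^{k-1}_{\mathrm{fin}}=\bigcup_{i<\ell}C_i$ there are $p\in(\omega)^\omega$ and $i<\ell$ such that $x\upharpoonright\mu^x(k-1)\in C_i$ for all $x\in(p)^k$. -/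

import Mathlib

/-!
Second order arithmetic. A structure for the language `L₂` consists of a number domain `M` with
`0, 1, +, ·, <` and a family `S` of subsets of `M`, over which the set variables range.
The principles below are read inside such a structure `(M, S)`: every quantifier
runs over `M`, over `S`, or over a standard finite index set `Fin ℓ`.
-/

namespace SecondOrderArith

universe u

/-- The first order part of an `L₂`-structure; no laws are assumed. -/
class NumStructure (M : Type u) extends Zero M, One M, Add M, Mul M, LT M

/-! ### Syntax and semantics of bounded formulas -/

/-- Numerical terms of `L₂`, with number variables `v₀, v₁, …`. -/
inductive NumTerm : Type
  | var : ℕ → NumTerm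
  | zero : NumTerm
  | one : NumTerm
  | add : NumTerm → NumTerm → NumTerm
  | mul : NumTerm → NumTerm → NumTerm

/-- Bounded quantifier formulas (`Σ⁰₀`) of `L₂`, with set variables `X₀, X₁, …`.
In `ball t φ` (`∀ v < t, φ`) and `bex t φ` (`∃ v < t, φ`) the bound variable is variable `0` of `φ`,
variable `i + 1` of `φ` is variable `i` outside, and `t` lives outside the quantifier. -/
inductive BddFormula : Type
  | eq : NumTerm → NumTerm → BddFormula
  | lt : NumTerm → NumTerm → BddFormula
  | mem : NumTerm → ℕ → BddFormula
  | neg : BddFormula → BddFormula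
  | and : BddFormula → BddFormula → BddFormula
  | or : BddFormula → BddFormula → BddFormula
  | ball : NumTerm → BddFormula → BddFormula
  | bex : NumTerm → BddFormula → BddFormula

section Semantics

variable {M : Type u} [NumStructure M]

/-- The assignment `v₀ ↦ a`, `vᵢ₊₁ ↦ e i`. -/
def push (a : M) (e : ℕ → M) : ℕ → M
  | 0 => a
  | i + 1 => e i

/-- Value of a term under an assignment of the number variables. -/
def NumTerm.val (e : ℕ → M) : NumTerm → M
  | .var i => e i
  | .zero => 0
  | .one => 1
  | .add s t => s.val e + t.val e
  | .mul s t => s.val e * t.val e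

/-- Truth of a bounded formula under an assignment of number and set variables. -/
def BddFormula.Holds (V : ℕ → Set M) : BddFormula → (ℕ → M) → Prop
  | .eq s t, e => s.val e = t.val e
  | .lt s t, e => s.val e < t.val e
  | .mem t i, e => t.val e ∈ V i
  | .neg φ, e => ¬ φ.Holds V e
  | .and φ ψ, e => φ.Holds V e ∧ ψ.Holds V e
  | .or φ ψ, e => φ.Holds V e ∨ ψ.Holds V e
  | .ball t φ, e => ∀ a : M, a < t.val e → φ.Holds V (push a e)
  | .bex t φ, e => ∃ a : M, a < t.val e ∧ φ.Holds V (push a e)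

/-- The `Σ⁰₁` formula `∃ v, θ` (with matrix `θ`) as a property of `n`, with parameters `e`, `V`. -/
def Sigma01 (θ : BddFormula) (e : ℕ → M) (V : ℕ → Set M) (n : M) : Prop :=
  ∃ a : M, θ.Holds V (push a (push n e))

/-- The `Π⁰₁` formula `∀ v, θ` (with matrix `θ`) as a property of `n`, with parameters `e`, `V`. -/
def Pi01 (θ : BddFormula) (e : ℕ → M) (V : ℕ → Set M) (n : M) : Prop :=
  ∀ a : M, θ.Holds V (push a (push n e))

/-- `(M, S)` is a model of `RCA₀`: the basic axioms, `Σ⁰₁` induction and `Δ⁰₁` comprehension,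
both schemes with number and set parameters. -/
structure IsModelRCA0 (S : Set (Set M)) : Prop where
  sets_nonempty : S.Nonempty
  succ_ne_zero : ∀ n : M, n + 1 ≠ 0
  succ_inj : ∀ m n : M, m + 1 = n + 1 → m = n
  add_zero : ∀ m : M, m + 0 = m
  add_succ : ∀ m n : M, m + (n + 1) = (m + n) + 1
  mul_zero : ∀ m : M, m * 0 = 0
  mul_succ : ∀ m n : M, m * (n + 1) = m * n + m
  not_lt_zero : ∀ m : M, ¬ m < 0
  lt_succ_iff : ∀ m n : M, m < n + 1 ↔ m < n ∨ m = n
  sigma01_induction : ∀ (θ : BddFormula) (e : ℕ → M) (V : ℕ → Set M), (∀ i, V i ∈ S) →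
    Sigma01 θ e V 0 → (∀ n, Sigma01 θ e V n → Sigma01 θ e V (n + 1)) → ∀ n, Sigma01 θ e V n
  delta01_comprehension : ∀ (θ ψ : BddFormula) (e : ℕ → M) (V : ℕ → Set M), (∀ i, V i ∈ S) →
    (∀ n, Sigma01 θ e V n ↔ Pi01 ψ e V n) → {n | Sigma01 θ e V n} ∈ S

/-! ### Coding of pairs, finite sets and finite sequences by numbers -/

/-- The element of `M` denoted by the standard number `n`. -/
def numeral (M : Type u) [NumStructure M] : ℕ → M
  | 0 => 0
  | n + 1 => numeral M n + 1

/-- The pairing function `⟨i, j⟩ = (i + j)² + i`. -/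
def pair (i j : M) : M := (i + j) * (i + j) + i

/-- `c = ⟨b, ⟨m, n⟩⟩` for some `b`, `m`, `n`. -/
def IsTriple (c : M) : Prop := ∃ b m n : M, c = pair b (pair m n)

/-- `x` belongs to the finite set given by `c = ⟨b, ⟨m, n⟩⟩`, that is, `x < b` and
`m (x + 1) + 1` divides `n`. -/
def InCode (c x : M) : Prop :=
  ∃ b m n : M, c = pair b (pair m n) ∧ x < b ∧ ∃ q : M, n = (m * (x + 1) + 1) * q

/-- `c` is the code of a finite set: the least triple that gives this set. -/
def IsFinSetCode (c : M) : Prop :=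
  IsTriple c ∧ ∀ c' : M, c' < c → IsTriple c' → ¬ ∀ x : M, InCode c' x ↔ InCode c x

/-- `s` is the code of a finite sequence of length `l`; the sequence is the finite set of the pairs
`⟨i, s(i)⟩`, `i < l`. -/
def IsSeq (s l : M) : Prop :=
  IsFinSetCode s ∧ (∀ x, InCode s x → ∃ i j, i < l ∧ x = pair i j) ∧
    ∀ i, i < l → ∃! j, InCode s (pair i j)

/-! ### Partitions -/

/-- The set `f` is (the graph of) a function from numbers to numbers. -/
def IsFun (f : Set M) : Prop :=
  (∀ x ∈ f, ∃ i j, x = pair i j) ∧ ∀ i, ∃! j, pair i j ∈ f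

/-- A graph `f` is ordered: a value occurs only after all smaller values have occurred. -/
def IsOrdered (f : Set M) : Prop :=
  ∀ n i, pair n i ∈ f → ∀ j, j < i → ∃ m, m < n ∧ pair m j ∈ f

/-- `p ∈ (ω)^ω`: `p` is an ordered surjective function from numbers to numbers. -/
def IsInfPartition (p : Set M) : Prop :=
  IsFun p ∧ IsOrdered p ∧ ∀ i, ∃ n, pair n i ∈ p

/-- `x ∈ (ω)^k`: `x` is an ordered surjective function from numbers to `{0, …, k - 1}`. -/
def IsPartition (k : ℕ) (x : Set M) : Prop :=
  IsFun x ∧ (∀ n i, pair n i ∈ x → i < numeral M k) ∧ IsOrdered x ∧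
    ∀ i, i < numeral M k → ∃ n, pair n i ∈ x

/-- `s ∈ (ω)^k_fin`: `s` is the code of an ordered finite sequence of numbers `< k` in which all
`i < k` appear. -/
def IsFinPartition (k : ℕ) (s : M) : Prop :=
  (∃ l, IsSeq s l) ∧ (∀ n i, InCode s (pair n i) → i < numeral M k) ∧
    IsOrdered {x | InCode s x} ∧ ∀ i, i < numeral M k → ∃ n, InCode s (pair n i)

/-- `x ∈ (p)^k`: `x` is a `k`-coarsening of `p`. -/
def IsCoarsening (k : ℕ) (p x : Set M) : Prop :=
  IsPartition k x ∧
    ∀ n m a, pair n a ∈ p → pair m a ∈ p → ∀ b, pair n b ∈ x → pair m b ∈ x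

/-- The finite sequence `s` is an initial segment of the function `x` (as graphs: `s ⊆ x`). -/
def IsPrefix (s : M) (x : Set M) : Prop := ∀ y, InCode s y → y ∈ x

/-- Of the finite sequences `s`, `t`, one is an initial segment of the other. -/
def Comparable (s t : M) : Prop :=
  (∀ y, InCode s y → InCode t y) ∨ ∀ y, InCode t y → InCode s y

/-- `m = μ^x(i)` is the least element of the `i`-th block of `x`. -/
def IsMu (x : Set M) (i m : M) : Prop := pair m i ∈ x ∧ ∀ m', m' < m → pair m' i ∉ x

/-- `s = x ↾ m`. -/
def IsRestriction (x : Set M) (m s : M) : Prop := IsSeq s m ∧ IsPrefix s x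

/-! ### Codes for open sets and for Baire colorings -/

/-- `O ⊆ ω × (ω)^k_fin`. -/
def IsOpenCode (k : ℕ) (O : Set M) : Prop :=
  ∀ z ∈ O, ∃ n s, z = pair n s ∧ IsFinPartition k s

/-- `x` is in the open set coded by `O`. -/
def InOpen (O x : Set M) : Prop := ∃ n s, pair n s ∈ O ∧ IsPrefix s x

/-- The open subset of `(ω)^k` coded by `O` is dense. -/
def IsDenseCode (k : ℕ) (O : Set M) : Prop :=
  ∀ t, IsFinPartition k t → ∃ n s, pair n s ∈ O ∧ Comparable s t

/-- `D ⊆ ω × ω × (ω)^k_fin`, a code for a sequence of open sets. -/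
def IsOpenSeqCode (k : ℕ) (D : Set M) : Prop :=
  ∀ z ∈ D, ∃ i n s, z = pair i (pair n s) ∧ IsFinPartition k s

/-- The code of the `i`-th open set in the sequence coded by `D`. -/
def openSection (D : Set M) (i : M) : Set M := {z | pair i z ∈ D}

/-- `O` and `D` form a code for a Baire `ℓ`-coloring of `(ω)^k`. -/
def IsBaireColoring (k : ℕ) {ℓ : ℕ} (O : Fin ℓ → Set M) (D : Set M) : Prop :=
  IsOpenSeqCode k D ∧ (∀ n, IsDenseCode k (openSection D n)) ∧
    (∀ i, IsOpenCode k (O i)) ∧ IsDenseCode k (⋃ i, O i)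

/-- The sets `O i` form an open `ℓ`-coloring of `(ω)^k`, in the structure `(M, S)`. -/
def IsOpenColoring (S : Set (Set M)) (k : ℕ) {ℓ : ℕ} (O : Fin ℓ → Set M) : Prop :=
  (∀ i, IsOpenCode k (O i)) ∧ ∀ x ∈ S, IsPartition k x → ∃ i, InOpen (O i) x

/-- The sets `C i` form an `ℓ`-coloring of `(ω)^k_fin`. -/
def IsStringColoring (k : ℕ) {ℓ : ℕ} (C : Fin ℓ → Set M) : Prop :=
  (∀ i, ∀ s ∈ C i, IsFinPartition k s) ∧ ∀ s, IsFinPartition k s → ∃ i, s ∈ C i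

/-! ### The three versions of the dual Ramsey theorem, in the structure `(M, S)` -/

/-- `Baire-DRT^k_ℓ` -/
def BaireDRT (S : Set (Set M)) (k ℓ : ℕ) : Prop :=
  ∀ (O : Fin ℓ → Set M) (D : Set M), (∀ i, O i ∈ S) → D ∈ S → IsBaireColoring k O D →
    ∃ p ∈ S, IsInfPartition p ∧ ∃ i : Fin ℓ, ∀ x ∈ S, IsCoarsening k p x →
      InOpen (O i) x ∧ ∀ n, InOpen (openSection D n) x

/-- `ODRT^k_ℓ` -/
def ODRT (S : Set (Set M)) (k ℓ : ℕ) : Prop :=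
  ∀ O : Fin ℓ → Set M, (∀ i, O i ∈ S) → IsOpenColoring S k O →
    ∃ p ∈ S, IsInfPartition p ∧ ∃ i : Fin ℓ, ∀ x ∈ S, IsCoarsening k p x → InOpen (O i) x

/-- `CDRT^k_ℓ` (used for `k ≥ 2`) -/
def CDRT (S : Set (Set M)) (k ℓ : ℕ) : Prop :=
  ∀ C : Fin ℓ → Set M, (∀ i, C i ∈ S) → IsStringColoring (k - 1) C →
    ∃ p ∈ S, IsInfPartition p ∧ ∃ i : Fin ℓ, ∀ x ∈ S, IsCoarsening k p x →
      ∃ m s, IsMu x (numeral M (k - 1)) m ∧ IsRestriction x m s ∧ s ∈ C i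

end Semantics

end SecondOrderArith

/-!
A cover of `(ω)^k` by open sets is a Baire coloring with trivial dense sets, and a coloring of the
strings in `(ω)^(k-1)_fin` is the clopen coloring of `x ∈ (ω)^k` by the color of `x ↾ μ^x(k-1)`.

For the way back from strings to Baire colorings, put `⋃ i, O i` in front of the sequence `D`. By
`Σ⁰₁` dependent choice there is a partition `y ∈ (ω)^ω` so generic that for every
`g ∈ (ω)^k_fin` of length `n + 1` the composition `g ∘ y` meets the first `n + 1` of these dense
open sets. Color a string `t` in `(ω)^(k-1)_fin` with some `i` such that `(t⌢(k-1)) ∘ y` meets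
`O i`. If `q` is homogeneous for this coloring of strings, then `q ∘ y` is homogeneous for the Baire
coloring: every `x ∈ (q ∘ y)^k` is `h ∘ y` for some `h ∈ (q)^k`, so `x ∈ O i` because of the initial
segment `h ↾ (μ^h(k-1) + 1)`, and `x ∈ D n` because of longer ones.

The metatheory is handled by three classes of predicates on assignments (bounded, `Σ⁰₁` and
`Δ⁰₁` with parameters), so that instance search shows that a given predicate is definable.
-/

namespace SecondOrderArith

universe u

/-- A family `sets` of subsets of the number domain `M` that makes it a model of `RCA₀`, fixed once
and for all as an instance; all definability below is with number parameters from `M` and set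
parameters from `sets`. -/
class RCA0Model (M : Type u) [NumStructure M] where
  sets : Set (Set M)
  isModel : IsModelRCA0 sets

open RCA0Model (sets)

section Definability

variable {M : Type u} [NumStructure M]

/-- The assignment `vᵢ ↦ e (i + 1)`; it undoes `push`. -/
abbrev tail (e : ℕ → M) : ℕ → M := fun i => e (i + 1)

/-- Terms with all variables shifted by one. -/
def NumTerm.shift : NumTerm → NumTerm
  | .var i => .var (i + 1)
  | .zero => .zero
  | .one => .one
  | .add s t => .add s.shift t.shift
  | .mul s t => .mul s.shift t.shift

theorem NumTerm.val_shift (t : NumTerm) (e : ℕ → M) : t.shift.val e = t.val (tail e) := by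
  induction t with
  | var i => rfl
  | zero => rfl
  | one => rfl
  | add s t hs ht => simp only [NumTerm.shift, NumTerm.val, hs, ht]
  | mul s t hs ht => simp only [NumTerm.shift, NumTerm.val, hs, ht]

/-- On the assignments in `D`, all coordinates of `g` and all constants from `A` are values of
terms. This is what is needed to translate statements about `g e` into formulas evaluated at `e`. -/
def Realizes (D : Set (ℕ → M)) (A : Set M) (g : (ℕ → M) → ℕ → M) : Prop :=
  (∀ i, ∃ t : NumTerm, ∀ e ∈ D, g e i = t.val e) ∧ ∀ a ∈ A, ∃ t : NumTerm, ∀ e ∈ D, a = t.val e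

theorem Realizes.mono {D : Set (ℕ → M)} {A B : Set M} {g : (ℕ → M) → ℕ → M}
    (h : Realizes D B g) (hAB : A ⊆ B) : Realizes D A g :=
  ⟨h.1, fun a ha => h.2 a (hAB ha)⟩

theorem Realizes.push {D : Set (ℕ → M)} {A : Set M} {g : (ℕ → M) → ℕ → M} (h : Realizes D A g) :
    Realizes {e | tail e ∈ D} A (fun e => push (e 0) (g (tail e))) := by
  refine ⟨fun i => ?_, fun a ha => ?_⟩
  · cases i with
    | zero => exact ⟨.var 0, fun _ _ => rfl⟩
    | succ i =>
      obtain ⟨t, ht⟩ := h.1 i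
      exact ⟨t.shift, fun e he => (ht _ he).trans (t.val_shift e).symm⟩
  · obtain ⟨t, ht⟩ := h.2 a ha
    exact ⟨t.shift, fun e he => (ht _ he).trans (t.val_shift e).symm⟩

/-- The map `f` on assignments is given by a term with parameters. -/
class inductive IsTerm : ((ℕ → M) → M) → Prop
  | var (i : ℕ) : IsTerm fun e => e i
  | const (c : M) : IsTerm fun _ => c
  | add {f g : (ℕ → M) → M} : IsTerm f → IsTerm g → IsTerm fun e => f e + g e
  | mul {f g : (ℕ → M) → M} : IsTerm f → IsTerm g → IsTerm fun e => f e * g e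

attribute [instance] IsTerm.var IsTerm.const

instance (f g : (ℕ → M) → M) [hf : IsTerm f] [hg : IsTerm g] : IsTerm fun e => f e + g e :=
  hf.add hg

instance (f g : (ℕ → M) → M) [hf : IsTerm f] [hg : IsTerm g] : IsTerm fun e => f e * g e :=
  hf.mul hg

/-- A substitution: a map between assignments all of whose coordinates are given by terms. -/
class IsSubst (σ : (ℕ → M) → ℕ → M) : Prop where
  out : ∀ i, IsTerm fun e => σ e i

instance IsSubst.id : IsSubst fun e : ℕ → M => e := ⟨fun i => .var i⟩

instance IsSubst.const (c : ℕ → M) : IsSubst fun _ => c := ⟨fun i => .const (c i)⟩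

instance IsSubst.tail (σ : (ℕ → M) → ℕ → M) [h : IsSubst σ] : IsSubst fun e => tail (σ e) :=
  ⟨fun i => h.out (i + 1)⟩

instance IsSubst.push (f : (ℕ → M) → M) (σ : (ℕ → M) → ℕ → M) [hf : IsTerm f] [hσ : IsSubst σ] :
    IsSubst fun e => push (f e) (σ e)
  where out i := by cases i with
    | zero => exact hf
    | succ i => exact hσ.out i

theorem IsTerm.comp {f : (ℕ → M) → M} (hf : IsTerm f) (σ : (ℕ → M) → ℕ → M) [hσ : IsSubst σ] :
    IsTerm fun e => f (σ e) := by
  induction hf with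
  | var i => exact hσ.out i
  | const c => exact .const c
  | add _ _ hf hg => exact hf.add hg
  | mul _ _ hf hg => exact hf.mul hg

theorem IsSubst.comp {σ : (ℕ → M) → ℕ → M} (hσ : IsSubst σ) (τ : (ℕ → M) → ℕ → M) [IsSubst τ] :
    IsSubst fun e => σ (τ e) :=
  ⟨fun i => (hσ.out i).comp τ⟩

/-- `Φ D g` holds for all translations `g` on `D` that realize a suitable finite set of constants:
the form in which the parameters of terms and formulas are collected. -/
def HoldsOfTranslations (Φ : Set (ℕ → M) → ((ℕ → M) → ℕ → M) → Prop) : Prop :=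
  ∃ A : Set M, A.Finite ∧ ∀ D g, Realizes D A g → Φ D g

theorem HoldsOfTranslations.and {Φ Ψ : Set (ℕ → M) → ((ℕ → M) → ℕ → M) → Prop}
    (hΦ : HoldsOfTranslations Φ) (hΨ : HoldsOfTranslations Ψ) :
    HoldsOfTranslations fun D g => Φ D g ∧ Ψ D g := by
  obtain ⟨A, hA, hΦ⟩ := hΦ
  obtain ⟨B, hB, hΨ⟩ := hΨ
  exact ⟨A ∪ B, hA.union hB, fun D g h =>
    ⟨hΦ D g (h.mono Set.subset_union_left), hΨ D g (h.mono Set.subset_union_right)⟩⟩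

theorem IsTerm.exists_numTerm {f : (ℕ → M) → M} (hf : IsTerm f) :
    HoldsOfTranslations fun D g => ∃ t : NumTerm, ∀ e ∈ D, f (g e) = t.val e := by
  induction hf with
  | var i => exact ⟨∅, Set.finite_empty, fun _ _ hg => hg.1 i⟩
  | const c => exact ⟨{c}, Set.finite_singleton c, fun _ _ hg => hg.2 c rfl⟩
  | add _ _ ihf ihg =>
    obtain ⟨A, hA, H⟩ := ihf.and ihg
    refine ⟨A, hA, fun D g h => ?_⟩
    obtain ⟨⟨s, hs⟩, t, ht⟩ := H D g h
    exact ⟨.add s t, fun e he => congrArg₂ (· + ·) (hs e he) (ht e he)⟩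
  | mul _ _ ihf ihg =>
    obtain ⟨A, hA, H⟩ := ihf.and ihg
    refine ⟨A, hA, fun D g h => ?_⟩
    obtain ⟨⟨s, hs⟩, t, ht⟩ := H D g h
    exact ⟨.mul s t, fun e he => congrArg₂ (· * ·) (hs e he) (ht e he)⟩

variable [RCA0Model M]

/-- The predicate on assignments is given by a bounded formula with parameters. -/
class inductive IsBdd : ((ℕ → M) → Prop) → Prop
  | eq {f g : (ℕ → M) → M} : IsTerm f → IsTerm g → IsBdd fun e => f e = g e
  | lt {f g : (ℕ → M) → M} : IsTerm f → IsTerm g → IsBdd fun e => f e < g e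
  | mem {X : Set M} {f : (ℕ → M) → M} : X ∈ sets → IsTerm f → IsBdd fun e => f e ∈ X
  | not {P : (ℕ → M) → Prop} : IsBdd P → IsBdd fun e => ¬ P e
  | and {P Q : (ℕ → M) → Prop} : IsBdd P → IsBdd Q → IsBdd fun e => P e ∧ Q e
  | ball {t : (ℕ → M) → M} {P : (ℕ → M) → M → Prop} :
      IsTerm t → IsBdd (fun e => P (tail e) (e 0)) → IsBdd fun e => ∀ a, a < t e → P e a

theorem IsBdd.congr {P Q : (ℕ → M) → Prop} (h : IsBdd P) (hPQ : ∀ e, Q e ↔ P e) : IsBdd Q := by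
  rwa [funext fun e => propext (hPQ e)]

section

variable (f g : (ℕ → M) → M) [hf : IsTerm f] [hg : IsTerm g]

instance : IsBdd fun e => f e = g e := .eq hf hg

instance : IsBdd fun e => f e < g e := .lt hf hg

variable (P Q : (ℕ → M) → Prop) [hP : IsBdd P] [hQ : IsBdd Q]

instance : IsBdd fun e => ¬ P e := hP.not

instance : IsBdd fun e => P e ∧ Q e := hP.and hQ

instance : IsBdd fun e => P e ∨ Q e :=
  (inferInstance : IsBdd fun e => ¬ (¬ P e ∧ ¬ Q e)).congr fun e => by tauto

instance : IsBdd fun e => P e → Q e :=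
  (inferInstance : IsBdd fun e => ¬ (P e ∧ ¬ Q e)).congr fun e => by tauto

variable (R : (ℕ → M) → M → Prop) [hR : IsBdd fun e => R (tail e) (e 0)]

instance : IsBdd fun e => ∀ a, a < f e → R e a := .ball hf hR

instance : IsBdd fun e => ∃ a, a < f e ∧ R e a :=
  (inferInstance : IsBdd fun e => ¬ ∀ a, a < f e → ¬ R e a).congr fun e => by push Not; rfl

end

theorem IsBdd.comp {P : (ℕ → M) → Prop} (hP : IsBdd P) (σ : (ℕ → M) → ℕ → M) [hσ : IsSubst σ] :
    IsBdd fun e => P (σ e) := by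
  induction hP generalizing σ with
  | eq hf hg => exact .eq (hf.comp σ) (hg.comp σ)
  | lt hf hg => exact .lt (hf.comp σ) (hg.comp σ)
  | mem hX hf => exact .mem hX (hf.comp σ)
  | not _ ih => exact (ih σ).not
  | and _ _ ihP ihQ => exact (ihP σ).and (ihQ σ)
  | ball ht _ ih =>
    have := hσ.comp tail
    exact .ball (ht.comp σ) (ih fun e => push (e 0) (σ (tail e)))

theorem IsBdd.exists_bddFormula {P : (ℕ → M) → Prop} (hP : IsBdd P) :
    ∃ A : Set M, A.Finite ∧ ∃ G : Set (Set M), G.Finite ∧ G ⊆ sets ∧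
      ∀ D g V, Realizes D A g → G ⊆ Set.range V →
        ∃ θ : BddFormula, ∀ e ∈ D, P (g e) ↔ θ.Holds V e := by
  induction hP with
  | eq hf hg =>
    obtain ⟨A, hA, H⟩ := hf.exists_numTerm.and hg.exists_numTerm
    refine ⟨A, hA, ∅, Set.finite_empty, Set.empty_subset _, fun D g V h _ => ?_⟩
    obtain ⟨⟨s, hs⟩, t, ht⟩ := H D g h
    exact ⟨.eq s t, fun e he => by simp only [BddFormula.Holds, hs e he, ht e he]⟩
  | lt hf hg =>
    obtain ⟨A, hA, H⟩ := hf.exists_numTerm.and hg.exists_numTerm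
    refine ⟨A, hA, ∅, Set.finite_empty, Set.empty_subset _, fun D g V h _ => ?_⟩
    obtain ⟨⟨s, hs⟩, t, ht⟩ := H D g h
    exact ⟨.lt s t, fun e he => by simp only [BddFormula.Holds, hs e he, ht e he]⟩
  | @mem X _ hX hf =>
    obtain ⟨A, hA, hf⟩ := hf.exists_numTerm
    refine ⟨A, hA, {X}, Set.finite_singleton X, Set.singleton_subset_iff.2 hX,
      fun D g V h hV => ?_⟩
    obtain ⟨t, ht⟩ := hf D g h
    obtain ⟨i, rfl⟩ := hV rfl
    exact ⟨.mem t i, fun e he => by simp only [BddFormula.Holds, ht e he]⟩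
  | not _ ih =>
    obtain ⟨A, hA, G, hG, hGS, H⟩ := ih
    refine ⟨A, hA, G, hG, hGS, fun D g V h hV => ?_⟩
    obtain ⟨θ, hθ⟩ := H D g V h hV
    exact ⟨.neg θ, fun e he => not_congr (hθ e he)⟩
  | and _ _ ihP ihQ =>
    obtain ⟨A, hA, G, hG, hGS, HP⟩ := ihP
    obtain ⟨B, hB, F, hF, hFS, HQ⟩ := ihQ
    refine ⟨A ∪ B, hA.union hB, G ∪ F, hG.union hF, Set.union_subset hGS hFS,
      fun D g V h hV => ?_⟩
    rw [Set.union_subset_iff] at hV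
    obtain ⟨θ, hθ⟩ := HP D g V (h.mono Set.subset_union_left) hV.1
    obtain ⟨ψ, hψ⟩ := HQ D g V (h.mono Set.subset_union_right) hV.2
    exact ⟨.and θ ψ, fun e he => and_congr (hθ e he) (hψ e he)⟩
  | ball ht _ ih =>
    obtain ⟨A, hA, ht⟩ := ht.exists_numTerm
    obtain ⟨B, hB, G, hG, hGS, H⟩ := ih
    refine ⟨A ∪ B, hA.union hB, G, hG, hGS, fun D g V h hV => ?_⟩
    obtain ⟨t, ht⟩ := ht D g (h.mono Set.subset_union_left)
    obtain ⟨θ, hθ⟩ := H _ _ V (h.mono Set.subset_union_right).push hV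
    refine ⟨.ball t θ, fun e he => ?_⟩
    simp only [BddFormula.Holds, ← ht e he]
    exact forall₂_congr fun a _ => hθ (push a e) he

theorem exists_insert_eq_range {α : Type*} {A : Set α} (hA : A.Finite) (a : α) :
    ∃ e : ℕ → α, insert a A = Set.range e :=
  (hA.insert a).countable.exists_eq_range ⟨a, Set.mem_insert _ _⟩

theorem IsBdd.exists_bddFormula₂ {P Q : (ℕ → M) → Prop} (hP : IsBdd P) (hQ : IsBdd Q) :
    ∃ (θ ψ : BddFormula) (c : ℕ → M) (V : ℕ → Set M), (∀ i, V i ∈ sets) ∧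
      (∀ n a, P (push a (push n 0)) ↔ θ.Holds V (push a (push n c))) ∧
      ∀ n a, Q (push a (push n 0)) ↔ ψ.Holds V (push a (push n c)) := by
  obtain ⟨X, hX⟩ := (RCA0Model.isModel (M := M)).sets_nonempty
  obtain ⟨A, hA, G, hG, hGS, HP⟩ := hP.exists_bddFormula
  obtain ⟨B, hB, F, hF, hFS, HQ⟩ := hQ.exists_bddFormula
  obtain ⟨c, hc⟩ := exists_insert_eq_range (hA.union hB) 0
  obtain ⟨V, hV⟩ := exists_insert_eq_range (hG.union hF) X
  have hVS : ∀ i, V i ∈ sets := fun i => by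
    have : insert X (G ∪ F) ⊆ sets := Set.insert_subset hX (Set.union_subset hGS hFS)
    exact this (hV ▸ Set.mem_range_self i)
  have hg : Realizes {e | tail (tail e) = c} (A ∪ B)
      fun e => push (e 0) (push (e 1) (0 : ℕ → M)) := by
    refine ⟨fun i => ?_, fun a ha => ?_⟩
    · match i with
      | 0 => exact ⟨.var 0, fun _ _ => rfl⟩
      | 1 => exact ⟨.var 1, fun _ _ => rfl⟩
      | _ + 2 => exact ⟨.zero, fun _ _ => rfl⟩
    · obtain ⟨i, rfl⟩ : a ∈ Set.range c := hc ▸ Set.mem_insert_of_mem _ ha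
      exact ⟨.var (i + 2), fun e he => congrFun he.symm i⟩
  have hGF : G ∪ F ⊆ Set.range V := hV ▸ Set.subset_insert _ _
  rw [Set.union_subset_iff] at hGF
  obtain ⟨θ, hθ⟩ := HP _ _ V (hg.mono Set.subset_union_left) hGF.1
  obtain ⟨ψ, hψ⟩ := HQ _ _ V (hg.mono Set.subset_union_right) hGF.2
  exact ⟨θ, ψ, c, V, hVS, fun n a => hθ (push a (push n c)) rfl,
    fun n a => hψ (push a (push n c)) rfl⟩

theorem IsBdd.exists_induction {P : M → M → Prop} (hP : IsBdd fun e => P (e 1) (e 0))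
    (h0 : ∃ a, P 0 a) (h1 : ∀ n, (∃ a, P n a) → ∃ a, P (n + 1) a) (n : M) : ∃ a, P n a := by
  obtain ⟨θ, _, c, V, hV, hθ, _⟩ := hP.exists_bddFormula₂ hP
  change ∀ n a, P n a ↔ _ at hθ
  simp only [hθ] at h0 h1 ⊢
  exact RCA0Model.isModel.sigma01_induction θ c V hV h0 h1 n

theorem bdd_induction (P : M → Prop) [hP : IsBdd fun e => P (e 0)]
    (h0 : P 0) (h1 : ∀ n, P n → P (n + 1)) (n : M) : P n :=
  ((hP.comp tail).exists_induction (P := fun n _ => P n) ⟨0, h0⟩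
    (fun n ⟨_, h⟩ => ⟨0, h1 n h⟩) n).elim fun _ => id

theorem IsBdd.exists_comprehension {P Q : M → M → Prop} (hP : IsBdd fun e => P (e 1) (e 0))
    (hQ : IsBdd fun e => Q (e 1) (e 0)) (h : ∀ n, (∃ a, P n a) ↔ ∀ a, Q n a) :
    {n | ∃ a, P n a} ∈ (sets : Set (Set M)) := by
  obtain ⟨θ, ψ, c, V, hV, hθ, hψ⟩ := hP.exists_bddFormula₂ hQ
  change ∀ n a, P n a ↔ _ at hθ
  change ∀ n a, Q n a ↔ _ at hψ
  simp only [hθ, hψ] at h ⊢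
  exact RCA0Model.isModel.delta01_comprehension θ ψ c V hV h

end Definability

/-- The laws of the nonnegative part of a discretely ordered ring, the theory `PA⁻`. -/
class PAMinus (M : Type u) [NumStructure M] : Prop where
  add_zero : ∀ a : M, a + 0 = a
  add_assoc : ∀ a b c : M, a + b + c = a + (b + c)
  add_comm : ∀ a b : M, a + b = b + a
  mul_zero : ∀ a : M, a * 0 = 0
  mul_one : ∀ a : M, a * 1 = a
  mul_assoc : ∀ a b c : M, a * b * c = a * (b * c)
  mul_comm : ∀ a b : M, a * b = b * a
  mul_add : ∀ a b c : M, a * (b + c) = a * b + a * c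
  add_right_cancel : ∀ a b c : M, a + c = b + c → a = b
  lt_iff_exists_eq_add : ∀ {a b : M}, a < b ↔ ∃ c, b = a + (c + 1)
  lt_trichotomy : ∀ a b : M, a < b ∨ a = b ∨ b < a
  add_one_ne_zero : ∀ a : M, a + 1 ≠ 0
  eq_zero_or_eq_add_one : ∀ a : M, a = 0 ∨ ∃ b, a = b + 1

namespace RCA0Model

variable {M : Type u} [NumStructure M] [RCA0Model M]

protected theorem add_assoc (a b c : M) : a + b + c = a + (b + c) :=
  bdd_induction (fun c => a + b + c = a + (b + c))
    (by rw [isModel.add_zero, isModel.add_zero])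
    (fun n h => by rw [isModel.add_succ, h, isModel.add_succ, isModel.add_succ]) c

protected theorem zero_add (a : M) : 0 + a = a :=
  bdd_induction (fun a : M => 0 + a = a) (isModel.add_zero 0)
    (fun n h => by rw [isModel.add_succ, h]) a

theorem succ_add (a b : M) : a + 1 + b = a + b + 1 :=
  bdd_induction (fun b => a + 1 + b = a + b + 1) (by rw [isModel.add_zero, isModel.add_zero])
    (fun n h => by rw [isModel.add_succ, h, isModel.add_succ]) b

protected theorem add_comm (a b : M) : a + b = b + a :=
  bdd_induction (fun b => a + b = b + a) (by rw [isModel.add_zero, RCA0Model.zero_add])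
    (fun n h => by rw [isModel.add_succ, h, succ_add]) b

protected theorem add_right_cancel (a b c : M) : a + c = b + c → a = b :=
  bdd_induction (fun c => a + c = b + c → a = b)
    (fun h => by rwa [isModel.add_zero, isModel.add_zero] at h)
    (fun n ih h => ih (by
      rw [isModel.add_succ, isModel.add_succ] at h
      exact isModel.succ_inj _ _ h)) c

protected theorem mul_add (a b c : M) : a * (b + c) = a * b + a * c :=
  bdd_induction (fun c => a * (b + c) = a * b + a * c)
    (by rw [isModel.add_zero, isModel.mul_zero, isModel.add_zero])
    (fun n h => by
      rw [isModel.add_succ, isModel.mul_succ, h, isModel.mul_succ, RCA0Model.add_assoc]) c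

protected theorem mul_assoc (a b c : M) : a * b * c = a * (b * c) :=
  bdd_induction (fun c => a * b * c = a * (b * c))
    (by rw [isModel.mul_zero, isModel.mul_zero, isModel.mul_zero])
    (fun n h => by rw [isModel.mul_succ, isModel.mul_succ, h, RCA0Model.mul_add]) c

protected theorem mul_one (a : M) : a * 1 = a := by
  have := isModel.mul_succ a 0
  rwa [RCA0Model.zero_add, isModel.mul_zero, RCA0Model.zero_add] at this

protected theorem zero_mul (a : M) : 0 * a = 0 :=
  bdd_induction (fun a : M => 0 * a = 0) (isModel.mul_zero 0)
    (fun n h => by rw [isModel.mul_succ, h, isModel.add_zero]) a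

theorem succ_mul (a b : M) : (a + 1) * b = a * b + b :=
  bdd_induction (fun b => (a + 1) * b = a * b + b)
    (by rw [isModel.mul_zero, isModel.mul_zero, isModel.add_zero])
    (fun n h => by
      rw [isModel.mul_succ, h, isModel.mul_succ, RCA0Model.add_assoc, RCA0Model.add_assoc,
        ← RCA0Model.add_assoc n, RCA0Model.add_comm n a, RCA0Model.add_assoc]) b

protected theorem mul_comm (a b : M) : a * b = b * a :=
  bdd_induction (fun b => a * b = b * a) (by rw [isModel.mul_zero, RCA0Model.zero_mul])
    (fun n h => by rw [isModel.mul_succ, h, succ_mul]) b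

theorem lt_succ_self (a : M) : a < a + 1 :=
  (isModel.lt_succ_iff a a).2 (Or.inr rfl)

theorem lt_add_succ (a c : M) : a < a + (c + 1) :=
  bdd_induction (fun c => a < a + (c + 1)) (by rw [RCA0Model.zero_add]; exact lt_succ_self a)
    (fun n h => by rw [isModel.add_succ, isModel.lt_succ_iff]; exact Or.inl h) c

theorem eq_zero_or_eq_succ (a : M) : a = 0 ∨ ∃ b, a = b + 1 := by
  have := bdd_induction (fun a : M => a = 0 ∨ ∃ b, b < a ∧ a = b + 1) (Or.inl rfl)
    (fun n _ => Or.inr ⟨n, lt_succ_self n, rfl⟩) a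
  exact this.imp_right fun ⟨b, _, h⟩ => ⟨b, h⟩

theorem lt_succ_add (a c : M) : c < a + 1 + c := by
  rw [RCA0Model.add_comm]
  exact lt_add_succ c a

theorem exists_eq_add_succ_of_lt {a b : M} (hab : a < b) : ∃ c, b = a + (c + 1) := by
  have := bdd_induction (fun b => a < b → ∃ c, c < b ∧ b = a + (c + 1))
    (fun h => (isModel.not_lt_zero a h).elim) (fun n ih h => by
      rcases (isModel.lt_succ_iff a n).1 h with h | rfl
      · obtain ⟨c, -, rfl⟩ := ih h
        refine ⟨c + 1, ?_, (isModel.add_succ _ _).symm⟩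
        rw [← succ_add]
        exact lt_succ_add a _
      · refine ⟨0, ?_, by rw [RCA0Model.zero_add]⟩
        rw [← RCA0Model.zero_add (a + 1)]
        exact lt_add_succ 0 a) b hab
  exact this.imp fun c => And.right

theorem lt_or_eq_or_gt (a b : M) : a < b ∨ a = b ∨ b < a :=
  bdd_induction (fun b => a < b ∨ a = b ∨ b < a)
    (by
      rcases eq_zero_or_eq_succ a with rfl | ⟨a', rfl⟩
      · exact Or.inr (Or.inl rfl)
      · exact Or.inr (Or.inr (RCA0Model.zero_add (a' + 1) ▸ lt_add_succ 0 a')))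
    (fun n h => by
      rcases h with h | h | h
      · exact Or.inl ((isModel.lt_succ_iff _ _).2 (Or.inl h))
      · exact Or.inl ((isModel.lt_succ_iff _ _).2 (Or.inr h))
      · obtain ⟨c, rfl⟩ := exists_eq_add_succ_of_lt h
        rcases eq_zero_or_eq_succ c with rfl | ⟨c', rfl⟩
        · rw [RCA0Model.zero_add]
          exact Or.inr (Or.inl rfl)
        · rw [RCA0Model.add_comm (c' + 1), ← RCA0Model.add_assoc]
          exact Or.inr (Or.inr (lt_add_succ _ _))) b

instance : PAMinus M where
  add_zero := isModel.add_zero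
  add_assoc := RCA0Model.add_assoc
  add_comm := RCA0Model.add_comm
  mul_zero := isModel.mul_zero
  mul_one := RCA0Model.mul_one
  mul_assoc := RCA0Model.mul_assoc
  mul_comm := RCA0Model.mul_comm
  mul_add := RCA0Model.mul_add
  add_right_cancel := RCA0Model.add_right_cancel
  lt_iff_exists_eq_add := ⟨exists_eq_add_succ_of_lt, by rintro ⟨c, rfl⟩; exact lt_add_succ _ c⟩
  lt_trichotomy := lt_or_eq_or_gt
  add_one_ne_zero := isModel.succ_ne_zero
  eq_zero_or_eq_add_one := eq_zero_or_eq_succ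

end RCA0Model

section PAMinus

variable {M : Type u} [NumStructure M] [PAMinus M]

instance : CommSemiring M where
  add_assoc := PAMinus.add_assoc
  zero_add a := by rw [PAMinus.add_comm, PAMinus.add_zero]
  add_zero := PAMinus.add_zero
  add_comm := PAMinus.add_comm
  left_distrib := PAMinus.mul_add
  right_distrib a b c := by
    rw [PAMinus.mul_comm, PAMinus.mul_add, PAMinus.mul_comm c a, PAMinus.mul_comm c b]
  zero_mul a := by rw [PAMinus.mul_comm, PAMinus.mul_zero]
  mul_zero := PAMinus.mul_zero
  mul_assoc := PAMinus.mul_assoc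
  one_mul a := by rw [PAMinus.mul_comm, PAMinus.mul_one]
  mul_one := PAMinus.mul_one
  mul_comm := PAMinus.mul_comm
  nsmul := nsmulRec

instance : IsCancelAdd M :=
  { add_left_cancel a b c h := PAMinus.add_right_cancel b c a (by rwa [add_comm, add_comm c])
    add_right_cancel a b c h := PAMinus.add_right_cancel b c a h }

protected theorem PAMinus.lt_irrefl (a : M) : ¬ a < a := fun h => by
  obtain ⟨c, hc⟩ := PAMinus.lt_iff_exists_eq_add.1 h
  exact PAMinus.add_one_ne_zero c (left_eq_add.1 hc)

protected theorem PAMinus.lt_trans {a b c : M} (hab : a < b) (hbc : b < c) : a < c := by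
  obtain ⟨d, rfl⟩ := PAMinus.lt_iff_exists_eq_add.1 hab
  obtain ⟨e, rfl⟩ := PAMinus.lt_iff_exists_eq_add.1 hbc
  exact PAMinus.lt_iff_exists_eq_add.2 ⟨d + 1 + e, by ring⟩

instance : IsStrictTotalOrder M (· < ·) where
  irrefl := PAMinus.lt_irrefl
  trans _ _ _ := PAMinus.lt_trans
  trichotomous a b h h' := by
    rcases PAMinus.lt_trichotomy a b with hab | hab | hab
    · exact (h hab).elim
    · exact hab
    · exact (h' hab).elim

noncomputable instance : LinearOrder M :=
  @linearOrderOfSTO M (· < ·) _ (Classical.decRel _)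

instance : CanonicallyOrderedAdd M where
  exists_add_of_le {a b} h := by
    rcases h.lt_or_eq with h | rfl
    · obtain ⟨c, hc⟩ := PAMinus.lt_iff_exists_eq_add.1 h
      exact ⟨c + 1, hc⟩
    · exact ⟨0, (add_zero a).symm⟩
  le_add_self a b := by
    rcases PAMinus.eq_zero_or_eq_add_one b with rfl | ⟨c, rfl⟩
    · rw [zero_add]
    · exact (PAMinus.lt_iff_exists_eq_add.2 ⟨c, add_comm _ _⟩).le
  le_self_add a b := by
    rcases PAMinus.eq_zero_or_eq_add_one b with rfl | ⟨c, rfl⟩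
    · rw [add_zero]
    · exact (PAMinus.lt_iff_exists_eq_add.2 ⟨c, rfl⟩).le

instance : Nontrivial M := ⟨0, 0 + 1, (PAMinus.add_one_ne_zero 0).symm⟩

instance : IsOrderedCancelAddMonoid M :=
  have add_lt (a b c : M) (h : a < b) : a + c < b + c := by
    obtain ⟨d, rfl⟩ := PAMinus.lt_iff_exists_eq_add.1 h
    exact PAMinus.lt_iff_exists_eq_add.2 ⟨d, by ring⟩
  { add_le_add_left a b h c := h.lt_or_eq.elim (fun h => (add_lt a b c h).le) fun h => h ▸ le_rfl
    le_of_add_le_add_left c a b h := not_lt.1 fun hlt =>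
      h.not_gt (by simpa only [add_comm c] using add_lt b a c hlt) }

instance : IsStrictOrderedRing M :=
  have mul_lt (a b c : M) (h : a < b) (hc : 0 < c) : a * c < b * c := by
    obtain ⟨d, rfl⟩ := PAMinus.lt_iff_exists_eq_add.1 h
    obtain ⟨e, rfl⟩ := PAMinus.lt_iff_exists_eq_add.1 hc
    exact PAMinus.lt_iff_exists_eq_add.2 ⟨d * e + d + e, by ring⟩
  { zero_le_one := zero_le
    mul_lt_mul_of_pos_left c hc a b h := by
      simpa only [mul_comm c] using mul_lt a b c h hc
    mul_lt_mul_of_pos_right c hc a b h := mul_lt a b c h hc }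

noncomputable instance : SuccOrder M :=
  SuccOrder.ofSuccLeIff (· + 1) fun {a b} => by
    refine ⟨fun h => (lt_add_one a).trans_le h, fun h => ?_⟩
    obtain ⟨c, rfl⟩ := PAMinus.lt_iff_exists_eq_add.1 h
    rw [add_comm c, ← add_assoc]
    exact le_self_add

noncomputable instance : SuccAddOrder M := ⟨fun _ => rfl⟩

end PAMinus

section Sigma

variable {M : Type u} [NumStructure M] [RCA0Model M]

/-- The predicate on assignments is `Σ⁰₁` with parameters. -/
class IsSigma (P : (ℕ → M) → Prop) : Prop where
  out : ∃ Q : (ℕ → M) → Prop, IsBdd Q ∧ ∀ e, P e ↔ ∃ a, Q (push a e)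

/-- The predicate on assignments is `Δ⁰₁` with parameters: it and its negation are `Σ⁰₁`. -/
class IsDelta (P : (ℕ → M) → Prop) : Prop where
  sigma : IsSigma P
  pi : IsSigma fun e => ¬ P e

/-- The map on assignments is `Δ⁰₁`-definable with parameters. Its graph is required to be `Σ⁰₁`,
with the value in variable `0` and the arguments in the variables after it. -/
class IsFn (f : (ℕ → M) → M) : Prop where
  out : IsSigma fun e => e 0 = f (tail e)

theorem IsSigma.congr {P Q : (ℕ → M) → Prop} (h : IsSigma P) (hPQ : ∀ e, Q e ↔ P e) :
    IsSigma Q := by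
  rwa [funext fun e => propext (hPQ e)]

theorem IsDelta.congr {P Q : (ℕ → M) → Prop} (h : IsDelta P) (hPQ : ∀ e, Q e ↔ P e) :
    IsDelta Q := by
  rwa [funext fun e => propext (hPQ e)]

theorem IsBdd.isSigma {P : (ℕ → M) → Prop} (h : IsBdd P) : IsSigma P :=
  ⟨fun e => P (tail e), h.comp tail, fun _ => ⟨fun h => ⟨0, h⟩, fun ⟨_, h⟩ => h⟩⟩

theorem IsBdd.isDelta {P : (ℕ → M) → Prop} (h : IsBdd P) : IsDelta P :=
  ⟨h.isSigma, h.not.isSigma⟩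

theorem IsSigma.comp {P : (ℕ → M) → Prop} (h : IsSigma P) (σ : (ℕ → M) → ℕ → M)
    [hσ : IsSubst σ] : IsSigma fun e => P (σ e) := by
  obtain ⟨Q, hQ, H⟩ := h.out
  have := hσ.comp tail
  exact ⟨fun e => Q (push (e 0) (σ (tail e))), hQ.comp _, fun e => H (σ e)⟩

theorem IsDelta.comp {P : (ℕ → M) → Prop} (h : IsDelta P) (σ : (ℕ → M) → ℕ → M) [IsSubst σ] :
    IsDelta fun e => P (σ e) :=
  ⟨h.sigma.comp σ, h.pi.comp σ⟩

theorem IsFn.comp {f : (ℕ → M) → M} (h : IsFn f) (σ : (ℕ → M) → ℕ → M) [hσ : IsSubst σ] :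
    IsFn fun e => f (σ e) :=
  have := hσ.comp tail
  ⟨h.out.comp fun e => push (e 0) (σ (tail e))⟩

theorem IsTerm.isFn {f : (ℕ → M) → M} (hf : IsTerm f) : IsFn f :=
  ⟨(IsBdd.eq (.var 0) (hf.comp tail)).isSigma⟩

instance IsFn.var (i : ℕ) : IsFn fun e : ℕ → M => e i := (IsTerm.var i).isFn

instance IsFn.const (c : M) : IsFn fun _ : ℕ → M => c := (IsTerm.const c).isFn

instance (P : (ℕ → M) → Prop) [h : IsDelta P] : IsSigma P := h.sigma

instance IsDelta.not (P : (ℕ → M) → Prop) [h : IsDelta P] : IsDelta fun e => ¬ P e :=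
  ⟨h.pi, h.sigma.congr fun _ => not_not⟩

theorem sigma_induction (P : M → Prop) [h : IsSigma fun e => P (e 0)]
    (h0 : P 0) (h1 : ∀ n, P n → P (n + 1)) (n : M) : P n := by
  obtain ⟨Q, hQ, H⟩ := h.out
  have hP : ∀ n, P n ↔ ∃ a, Q (push a (push n 0)) := fun n => H (push n 0)
  simp only [hP] at h0 h1 ⊢
  exact (hQ.comp fun e => push (e 0) (push (e 1) 0)).exists_induction h0 h1 n

theorem delta_comprehension (P : M → Prop) [h : IsDelta fun e => P (e 0)] :
    {n | P n} ∈ (sets : Set (Set M)) := by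
  obtain ⟨Q, hQ, H⟩ := h.sigma.out
  obtain ⟨R, hR, K⟩ := h.pi.out
  have hP : ∀ n, P n ↔ ∃ a, Q (push a (push n 0)) := fun n => H (push n 0)
  have hP' : ∀ n, P n ↔ ∀ a, ¬ R (push a (push n 0)) := fun n =>
    not_iff_not.1 ((K (push n 0)).trans (by push Not; rfl))
  rw [show {n | P n} = {n | ∃ a, Q (push a (push n 0))} from Set.ext hP]
  exact (hQ.comp fun e => push (e 0) (push (e 1) 0)).exists_comprehension
    (hR.comp fun e => push (e 0) (push (e 1) 0)).not fun n => (hP n).symm.trans (hP' n)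

instance IsSigma.exists (P : (ℕ → M) → M → Prop) [h : IsSigma fun e => P (tail e) (e 0)] :
    IsSigma fun e => ∃ a, P e a := by
  obtain ⟨Q, hQ, H⟩ := h.out
  have := hQ.comp fun e => push (e 0) (push (e 1) (tail (tail (tail e))))
  refine ⟨fun e => ∃ a, a < e 0 ∧ ∃ b, b < e 0 ∧ Q (push b (push a (tail e))), inferInstance,
    fun e => ⟨?_, ?_⟩⟩
  · rintro ⟨a, ha⟩
    obtain ⟨b, hb⟩ := (H (push a e)).1 ha
    exact ⟨max a b + 1, a, Order.lt_add_one_iff.2 (le_max_left _ _), b,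
      Order.lt_add_one_iff.2 (le_max_right _ _), hb⟩
  · rintro ⟨_, a, _, b, _, hab⟩
    exact ⟨a, (H (push a e)).2 ⟨b, hab⟩⟩

section Connectives

variable (P Q : (ℕ → M) → Prop)

instance [hP : IsSigma P] [hQ : IsSigma Q] : IsSigma fun e => P e ∧ Q e := by
  obtain ⟨P', hP', HP⟩ := hP.out
  obtain ⟨Q', hQ', HQ⟩ := hQ.out
  have h1 := hP'.comp fun e => push (e 1) (tail (tail e))
  have h2 := hQ'.comp fun e => push (e 0) (tail (tail e))
  have : IsSigma fun e => P' (push (e 1) (tail (tail e))) ∧ Q' (push (e 0) (tail (tail e))) :=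
    (h1.and h2).isSigma
  refine (inferInstance : IsSigma fun e => ∃ a b, P' (push a e) ∧ Q' (push b e)).congr fun e => ?_
  rw [HP, HQ]
  exact ⟨fun ⟨⟨a, ha⟩, b, hb⟩ => ⟨a, b, ha, hb⟩, fun ⟨a, b, ha, hb⟩ => ⟨⟨a, ha⟩, b, hb⟩⟩

instance [hP : IsSigma P] [hQ : IsSigma Q] : IsSigma fun e => P e ∨ Q e := by
  obtain ⟨P', hP', HP⟩ := hP.out
  obtain ⟨Q', hQ', HQ⟩ := hQ.out
  refine ⟨fun e => P' e ∨ Q' e, inferInstance, fun e => ?_⟩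
  rw [HP, HQ, exists_or]

instance IsSigma.exists_fin {n : ℕ} (P : Fin n → (ℕ → M) → Prop) [h : ∀ i, IsSigma (P i)] :
    IsSigma fun e => ∃ i, P i e := by
  induction n with
  | zero =>
    exact (IsBdd.lt (.const 0) (.const 0)).isSigma.congr fun e => by
      simp only [IsEmpty.exists_iff, lt_irrefl]
  | succ n ih =>
    have := ih fun i => P i.succ
    exact (inferInstance : IsSigma fun e => P 0 e ∨ ∃ i : Fin n, P i.succ e).congr
      fun e => Fin.exists_fin_succ

variable [hP : IsDelta P]

instance [IsSigma Q] : IsSigma fun e => P e → Q e :=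
  (inferInstance : IsSigma fun e => ¬ P e ∨ Q e).congr fun e => by tauto

variable [hQ : IsDelta Q]

instance : IsDelta fun e => P e ∧ Q e :=
  ⟨inferInstance, (inferInstance : IsSigma fun e => ¬ P e ∨ ¬ Q e).congr fun e => by tauto⟩

instance : IsDelta fun e => P e ∨ Q e :=
  (inferInstance : IsDelta fun e => ¬ (¬ P e ∧ ¬ Q e)).congr fun e => by tauto

instance : IsDelta fun e => P e → Q e :=
  (inferInstance : IsDelta fun e => ¬ (P e ∧ ¬ Q e)).congr fun e => by tauto

instance : IsDelta fun e => P e ↔ Q e :=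
  (inferInstance : IsDelta fun e => (P e → Q e) ∧ (Q e → P e)).congr fun e => by tauto

instance IsDelta.exists_fin {n : ℕ} (P : Fin n → (ℕ → M) → Prop) [h : ∀ i, IsDelta (P i)] :
    IsDelta fun e => ∃ i, P i e := by
  induction n with
  | zero =>
    exact (IsBdd.lt (.const 0) (.const 0)).isDelta.congr fun e => by
      simp only [IsEmpty.exists_iff, lt_irrefl]
  | succ n ih =>
    have := ih fun i => P i.succ
    exact (inferInstance : IsDelta fun e => P 0 e ∨ ∃ i : Fin n, P i.succ e).congr
      fun e => Fin.exists_fin_succ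

end Connectives

section Substitution

theorem IsSigma.subst {P : (ℕ → M) → M → Prop} (h : IsSigma fun e => P (tail e) (e 0))
    (f : (ℕ → M) → M) [hf : IsFn f] : IsSigma fun e => P e (f e) := by
  have := hf.out
  exact (inferInstance : IsSigma fun e => ∃ v, v = f e ∧ P e v).congr fun e => by
    rw [exists_eq_left]

variable (f g k : (ℕ → M) → M) [hf : IsFn f] [hg : IsFn g] [hk : IsFn k]

theorem IsSigma.comp₁ {P : M → Prop} (h : IsSigma fun e => P (e 0)) : IsSigma fun e => P (f e) :=
  IsSigma.subst (P := fun _ v => P v) h f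

theorem IsSigma.comp₂ {P : M → M → Prop} (h : IsSigma fun e => P (e 0) (e 1)) :
    IsSigma fun e => P (f e) (g e) := by
  have := hg.comp tail
  exact IsSigma.subst (P := fun e v => P v (g e)) (IsSigma.subst (P := fun e v => P (e 0) v)
    (h.comp fun e => push (e 1) (push (e 0) e)) fun e => g (tail e)) f

theorem IsSigma.comp₃ {P : M → M → M → Prop} (h : IsSigma fun e => P (e 0) (e 1) (e 2)) :
    IsSigma fun e => P (f e) (g e) (k e) := by
  have := hg.comp tail
  have := hk.comp fun e => tail (tail e)
  exact IsSigma.subst (P := fun e v => P v (g e) (k e)) (IsSigma.subst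
    (P := fun e v => P (e 0) v (k (tail e))) (IsSigma.subst (P := fun e v => P (e 1) (e 0) v)
    (h.comp fun e => push (e 2) (push (e 1) (push (e 0) e))) fun e => k (tail (tail e)))
    fun e => g (tail e)) f

theorem IsDelta.comp₁ {P : M → Prop} (h : IsDelta fun e => P (e 0)) : IsDelta fun e => P (f e) :=
  ⟨h.sigma.comp₁ f, h.pi.comp₁ (P := fun v => ¬ P v) f⟩

theorem IsDelta.comp₂ {P : M → M → Prop} (h : IsDelta fun e => P (e 0) (e 1)) :
    IsDelta fun e => P (f e) (g e) :=
  ⟨h.sigma.comp₂ f g, h.pi.comp₂ (P := fun v w => ¬ P v w) f g⟩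

instance : IsDelta fun e => f e = g e :=
  (IsBdd.eq (.var 0) (.var 1)).isDelta.comp₂ (P := fun a b => a = b) f g

instance : IsDelta fun e => f e < g e :=
  (IsBdd.lt (.var 0) (.var 1)).isDelta.comp₂ (P := fun a b => a < b) f g

instance : IsDelta fun e => f e ≤ g e :=
  (inferInstance : IsDelta fun e => ¬ g e < f e).congr fun _ => not_lt.symm

instance (X : Set M) [hX : Fact (X ∈ sets)] : IsDelta fun e => f e ∈ X :=
  (IsBdd.mem hX.out (.var 0)).isDelta.comp₁ (P := fun a => a ∈ X) f

theorem IsFn.comp₁ {F : M → M} (h : IsFn fun e => F (e 0)) : IsFn fun e => F (f e) :=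
  have := hf.comp tail
  ⟨h.out.comp₂ (P := fun a b => a = F b) _ _⟩

theorem IsFn.comp₂ {F : M → M → M} (h : IsFn fun e => F (e 0) (e 1)) :
    IsFn fun e => F (f e) (g e) :=
  have := hf.comp tail
  have := hg.comp tail
  ⟨h.out.comp₃ (P := fun a b c => a = F b c) _ _ _⟩

instance : IsFn fun e => f e + g e :=
  IsFn.comp₂ f g (F := fun a b => a + b) ((IsTerm.var 0).add (.var 1)).isFn

instance : IsFn fun e => f e * g e :=
  IsFn.comp₂ f g (F := fun a b => a * b) ((IsTerm.var 0).mul (.var 1)).isFn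

instance : IsFn fun e => pair (f e) (g e) :=
  inferInstanceAs (IsFn fun e => (f e + g e) * (f e + g e) + f e)

end Substitution

section BoundedQuantifiers

theorem IsBdd.collection {Q : M → M → Prop} (hQ : IsBdd fun e => Q (e 1) (e 0)) {n : M}
    (h : ∀ a, a < n → ∃ w, Q a w) : ∃ c, ∀ a, a < n → ∃ w, w < c ∧ Q a w := by
  have : IsBdd fun e => ∀ a, a < e 1 → a < n → ∃ w, w < e 0 ∧ Q a w := by
    have := hQ.comp fun e => push (e 0) (push (e 1) e)
    infer_instance
  obtain ⟨c, hc⟩ := this.exists_induction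
    (P := fun m c => ∀ a, a < m → a < n → ∃ w, w < c ∧ Q a w)
    ⟨0, fun a ha => absurd ha not_lt_zero⟩ (fun m ⟨c, hc⟩ => by
      by_cases hm : m < n
      · obtain ⟨w, hw⟩ := h m hm
        refine ⟨max c (w + 1), fun a ha han => ?_⟩
        rcases (Order.lt_add_one_iff.1 ha).lt_or_eq with ham | rfl
        · obtain ⟨v, hv, hv'⟩ := hc a ham han
          exact ⟨v, hv.trans_le (le_max_left _ _), hv'⟩
        · exact ⟨w, (lt_add_one w).trans_le (le_max_right _ _), hw⟩
      · exact ⟨c, fun a _ han => hc a (han.trans_le (not_lt.1 hm)) han⟩) n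
  exact ⟨c, fun a ha => hc a ha ha⟩

variable (t : (ℕ → M) → M) (P : (ℕ → M) → M → Prop) [ht : IsFn t]

instance IsSigma.ball [h : IsSigma fun e => P (tail e) (e 0)] :
    IsSigma fun e => ∀ a, a < t e → P e a := by
  obtain ⟨Q, hQ, H⟩ := h.out
  suffices IsSigma fun e => ∀ a, a < e 0 → P (tail e) a from
    this.subst (P := fun e v => ∀ a, a < v → P e a) t
  have := hQ.comp fun e => push (e 0) (push (e 1) (tail (tail (tail (tail e)))))
  refine ⟨fun e => ∀ a, a < e 1 → ∃ w, w < e 0 ∧ Q (push w (push a (tail (tail e)))),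
    inferInstance, fun e => ⟨fun he => ?_, fun ⟨c, hc⟩ a ha => ?_⟩⟩
  · exact (hQ.comp fun e' => push (e' 0) (push (e' 1) (tail e))).collection
      (Q := fun a w => Q (push w (push a (tail e)))) fun a ha => (H (push a (tail e))).1 (he a ha)
  · obtain ⟨w, _, hw⟩ := hc a ha
    exact (H (push a (tail e))).2 ⟨w, hw⟩

variable [h : IsDelta fun e => P (tail e) (e 0)]

instance IsDelta.ball : IsDelta fun e => ∀ a, a < t e → P e a :=
  have := ht.comp tail
  ⟨inferInstance, (inferInstance : IsSigma fun e => ∃ a, a < t e ∧ ¬ P e a).congr fun e => by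
    push Not; rfl⟩

instance IsDelta.bex : IsDelta fun e => ∃ a, a < t e ∧ P e a :=
  (inferInstance : IsDelta fun e => ¬ ∀ a, a < t e → ¬ P e a).congr fun e => by push Not; rfl

instance IsDelta.bex_le : IsDelta fun e => ∃ a, a ≤ t e ∧ P e a :=
  (inferInstance : IsDelta fun e => ∃ a, a < t e + 1 ∧ P e a).congr fun e => by
    simp only [Order.lt_add_one_iff]

end BoundedQuantifiers

theorem exists_least (P : M → Prop) [h : IsDelta fun e => P (e 0)] {n : M} (hn : P n) :
    ∃ m, P m ∧ ∀ i, i < m → ¬ P i := by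
  by_contra! hcon
  have (f : (ℕ → M) → M) [IsFn f] : IsDelta fun e => P (f e) := h.comp₁ f
  exact sigma_induction (fun n => ∀ i, i < n → ¬ P i) (fun i hi => absurd hi not_lt_zero)
    (fun m hm i hi hPi => by
      obtain ⟨j, hj, hPj⟩ := hcon i hPi
      exact hm j (hj.trans_le (Order.lt_add_one_iff.1 hi)) hPj) (n + 1) n (lt_add_one n) hn

theorem IsDelta.exists_selector (R : (ℕ → M) → M → Prop) [h : IsDelta fun e => R (tail e) (e 0)]
    (hR : ∀ e, ∃ a, R e a) : ∃ f : (ℕ → M) → M, IsFn f ∧ ∀ e, R e (f e) := by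
  have hleast (e : ℕ → M) : ∃ a, R e a ∧ ∀ i, i < a → ¬ R e i := by
    obtain ⟨a, ha⟩ := hR e
    have : IsDelta fun e' => R e (e' 0) := h.comp fun e' => push (e' 0) e
    exact exists_least (R e) ha
  choose f hf hmin using hleast
  have : IsDelta fun e => R (tail (tail e)) (e 0) := h.comp fun e => push (e 0) (tail (tail e))
  refine ⟨f, ⟨(inferInstance : IsSigma fun e => R (tail e) (e 0) ∧
    ∀ i, i < e 0 → ¬ R (tail e) i).congr fun e => ⟨fun he => ?_, fun ⟨h, h'⟩ => ?_⟩⟩, hf⟩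
  · rw [he]
    exact ⟨hf _, hmin _⟩
  · exact le_antisymm (not_lt.1 fun hlt => h' _ hlt (hf _)) (not_lt.1 fun hlt => hmin _ _ hlt h)

theorem IsSigma.exists_selector (R : (ℕ → M) → M → Prop) [h : IsSigma fun e => R (tail e) (e 0)]
    (hR : ∀ e, ∃ a, R e a) : ∃ f : (ℕ → M) → M, IsFn f ∧ ∀ e, R e (f e) := by
  obtain ⟨Q, hQ, H⟩ := h.out
  have := (hQ.comp fun e => push (e 0) (push (e 1) (tail (tail (tail e))))).isDelta
  -- first bound a value together with its witness, then search for the value below that bound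
  obtain ⟨w, hw, hwQ⟩ := IsDelta.exists_selector
    (fun e w => ∃ a, a ≤ w ∧ ∃ b, b ≤ w ∧ Q (push b (push a e))) fun e => by
      obtain ⟨a, ha⟩ := hR e
      obtain ⟨b, hb⟩ := (H (push a e)).1 ha
      exact ⟨max a b, a, le_max_left _ _, b, le_max_right _ _, hb⟩
  have := hw.comp tail
  have := (hQ.comp fun e => push (e 0) (push (e 1) (tail (tail e)))).isDelta
  obtain ⟨f, hf, hfQ⟩ := IsDelta.exists_selector (fun e a => ∃ b, b ≤ w e ∧ Q (push b (push a e)))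
    fun e => (hwQ e).imp fun a => And.right
  exact ⟨f, hf, fun e => (H (push (f e) e)).2 ((hfQ e).imp fun b => And.right)⟩

theorem numeral_injective : Function.Injective (numeral M) :=
  (strictMono_nat_of_lt_succ fun n => lt_add_one (numeral M n)).injective

theorem sigma_reduction {ℓ : ℕ} (Q : M → Prop) (P : Fin ℓ → M → Prop)
    [hQ : IsDelta fun e => Q (e 0)] [hP : ∀ c, IsSigma fun e => P c (e 0)]
    (h : ∀ t, Q t → ∃ c, P c t) : ∃ C : Fin ℓ → Set M, (∀ c, C c ∈ sets) ∧
      (∀ c, ∀ t ∈ C c, Q t ∧ P c t) ∧ ∀ t, Q t → ∃ c, t ∈ C c := by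
  have (f : (ℕ → M) → M) [IsFn f] : IsDelta fun e => Q (f e) := hQ.comp₁ f
  have (c : Fin ℓ) (f : (ℕ → M) → M) [IsFn f] : IsSigma fun e => P c (f e) := (hP c).comp₁ f
  obtain ⟨f, hf, hfR⟩ := IsSigma.exists_selector
    (fun e a => Q (e 0) → ∃ c : Fin ℓ, a = numeral M c ∧ P c (e 0)) fun e => by
      by_cases he : Q (e 0)
      · obtain ⟨c, hc⟩ := h _ he
        exact ⟨numeral M c, fun _ => ⟨c, rfl, hc⟩⟩
      · exact ⟨0, fun h => absurd h he⟩
  have := hf.comp fun e => push (e 0) 0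
  refine ⟨fun c => {t | Q t ∧ f (push t 0) = numeral M c}, fun c => delta_comprehension _,
    fun c t ⟨ht, htc⟩ => ?_, fun t ht => ?_⟩
  · obtain ⟨d, hd, hdt⟩ := hfR (push t 0) ht
    obtain rfl := Fin.ext (numeral_injective (htc.symm.trans hd))
    exact ⟨ht, hdt⟩
  · obtain ⟨c, hc, -⟩ := hfR (push t 0) ht
    exact ⟨c, ht, hc⟩

end Sigma

section Coding

variable {M : Type u} [NumStructure M] [PAMinus M]

theorem left_le_pair (i j : M) : i ≤ pair i j := le_add_self

theorem right_le_pair (i j : M) : j ≤ pair i j := by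
  have le_mul_self (a : M) : a ≤ a * a := by
    rcases PAMinus.eq_zero_or_eq_add_one a with rfl | ⟨b, rfl⟩
    · exact zero_le
    · exact le_mul_of_one_le_left zero_le le_add_self
  calc j ≤ i + j := le_add_self
    _ ≤ (i + j) * (i + j) := le_mul_self _
    _ ≤ pair i j := le_self_add

theorem pair_lt_pair_of_add_lt {i j i' j' : M} (h : i + j < i' + j') : pair i j < pair i' j' :=
  calc (i + j) * (i + j) + i ≤ (i + j) * (i + j) + (i + j) := by gcongr; exact le_self_add
    _ < (i + j) * (i + j) + (i + j) + (i + j + 1) :=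
        lt_add_of_pos_right _ (add_pos_of_nonneg_of_pos zero_le one_pos)
    _ = (i + j + 1) * (i + j + 1) := by ring
    _ ≤ (i' + j') * (i' + j') := by
        have := Order.add_one_le_iff.2 h
        exact mul_le_mul' this this
    _ ≤ pair i' j' := le_self_add

theorem pair_inj {i j i' j' : M} : pair i j = pair i' j' ↔ i = i' ∧ j = j' := by
  refine ⟨fun h => ?_, by rintro ⟨rfl, rfl⟩; rfl⟩
  have hs : i + j = i' + j' := by
    rcases lt_trichotomy (i + j) (i' + j') with hlt | heq | hlt
    · exact absurd h (pair_lt_pair_of_add_lt hlt).ne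
    · exact heq
    · exact absurd h (pair_lt_pair_of_add_lt hlt).ne'
  unfold pair at h
  rw [hs] at h
  obtain rfl : i = i' := add_left_cancel h
  exact ⟨rfl, add_left_cancel hs⟩

theorem exists_eq_triple_iff {c : M} {P : M → M → M → Prop} :
    (∃ b m n, c = pair b (pair m n) ∧ P b m n) ↔
      ∃ b, b ≤ c ∧ ∃ m, m ≤ c ∧ ∃ n, n ≤ c ∧ c = pair b (pair m n) ∧ P b m n := by
  refine ⟨?_, fun ⟨b, _, m, _, n, _, h⟩ => ⟨b, m, n, h⟩⟩
  rintro ⟨b, m, n, rfl, h⟩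
  have hmn := right_le_pair b (pair m n)
  exact ⟨b, left_le_pair _ _, m, (left_le_pair _ _).trans hmn, n, (right_le_pair _ _).trans hmn,
    rfl, h⟩

/-- The modulus `m (x + 1) + 1` that stands for the element `x` in the codes of finite sets. -/
def modulus (m x : M) : M := m * (x + 1) + 1

theorem inCode_pair {b m n x : M} : InCode (pair b (pair m n)) x ↔ x < b ∧ modulus m x ∣ n := by
  refine ⟨?_, fun ⟨hx, q, hq⟩ => ⟨b, m, n, rfl, hx, q, hq⟩⟩
  rintro ⟨b', m', n', h, hx, hq⟩
  rw [pair_inj, pair_inj] at h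
  obtain ⟨rfl, rfl, rfl⟩ := h
  exact ⟨hx, hq⟩

theorem InCode.lt {c x : M} (h : InCode c x) : x < c := by
  obtain ⟨b, m, n, rfl, hx, -⟩ := h
  exact hx.trans_le (left_le_pair _ _)

theorem InCode.left_lt {c i j : M} (h : InCode c (pair i j)) : i < c :=
  (left_le_pair i j).trans_lt h.lt

theorem InCode.right_lt {c i j : M} (h : InCode c (pair i j)) : j < c :=
  (right_le_pair i j).trans_lt h.lt

theorem IsFinSetCode.ext {c d : M} (hc : IsFinSetCode c) (hd : IsFinSetCode d)
    (h : ∀ x, InCode c x ↔ InCode d x) : c = d := by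
  rcases lt_trichotomy c d with hlt | heq | hlt
  · exact (hd.2 c hlt hc.1 h).elim
  · exact heq
  · exact (hc.2 d hlt hd.1 fun x => (h x).symm).elim

theorem le_of_dvd {a b : M} (hb : 0 < b) (h : a ∣ b) : a ≤ b := by
  obtain ⟨q, rfl⟩ := h
  exact le_mul_of_one_le_right zero_le (Order.one_le_iff_pos.2 (pos_of_mul_pos_right hb zero_le))

theorem dvd_of_dvd_add_left {a b d : M} (h : d ∣ a + b) (hb : d ∣ b) : d ∣ a := by
  obtain ⟨p, hp⟩ := h
  obtain ⟨q, rfl⟩ := hb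
  rcases eq_zero_or_pos d with rfl | hd
  · exact ⟨p, by simpa only [zero_mul, add_zero] using hp⟩
  · have hqp : q ≤ p := le_of_mul_le_mul_left (hp ▸ le_add_self) hd
    obtain ⟨r, rfl⟩ := exists_add_of_le hqp
    refine ⟨r, add_right_cancel (b := d * q) ?_⟩
    rw [hp, mul_add, add_comm]

theorem not_modulus_dvd_one {m : M} (hm : 0 < m) (x : M) : ¬ modulus m x ∣ 1 := fun h =>
  (le_of_dvd one_pos h).not_gt (lt_add_of_pos_left 1 (mul_pos hm (by positivity)))

theorem dvd_of_modulus_dvd_mul {b m n x y : M} (hm : ∀ j, j < b → j + 1 ∣ m) (hx : x < b)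
    (hy : y < b) (hxy : x ≠ y) (h : modulus m x ∣ n * modulus m y) : modulus m x ∣ n := by
  unfold modulus at h ⊢
  -- modulo `m * (x + 1) + 1` we have `m * (x + 1) = -1`, so `e * (x + 1) ^ 2`, where `m` is
  -- `e` times the distance of `x` and `y`, inverts `m * (y + 1) + 1` up to sign
  rcases lt_or_gt_of_ne hxy with hlt | hlt
  · obtain ⟨c, rfl⟩ := PAMinus.lt_iff_exists_eq_add.1 hlt
    obtain ⟨e, rfl⟩ := hm c ((lt_add_one c).trans_le le_add_self |>.trans hy)
    refine dvd_of_dvd_add_left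
      (b := ((c + 1) * e * (x + 1) + 1) * (e * (x + 1) * (x + (c + 1) + 1) * n)) ?_
      (dvd_mul_right _ _)
    convert (dvd_mul_right ((c + 1) * e * (x + 1) + 1) n).add
      (h.mul_left (e * (x + 1) * (x + 1))) using 1
    ring
  · obtain ⟨c, rfl⟩ := PAMinus.lt_iff_exists_eq_add.1 hlt
    obtain ⟨e, rfl⟩ := hm c ((lt_add_one c).trans_le le_add_self |>.trans hx)
    refine dvd_of_dvd_add_left (h := ?_) (h.mul_left (e * (y + (c + 1) + 1) * (y + (c + 1) + 1)))
    exact ⟨n + e * (y + (c + 1) + 1) * (y + 1) * n, by ring⟩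

end Coding

section FiniteSets

variable {M : Type u} [NumStructure M] [RCA0Model M]

section Definability

variable (f g : (ℕ → M) → M) [hf : IsFn f] [hg : IsFn g]

instance : IsFn fun e => modulus (f e) (g e) :=
  inferInstanceAs (IsFn fun e => f e * (g e + 1) + 1)

instance : IsDelta fun e => f e ∣ g e := by
  refine IsDelta.comp₂ f g (P := fun a b => a ∣ b) ?_
  refine (inferInstance : IsDelta fun e : ℕ → M => ∃ q, q ≤ e 1 ∧ e 1 = e 0 * q).congr
    fun e => ⟨fun h => ?_, fun ⟨q, _, hq⟩ => ⟨q, hq⟩⟩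
  rcases eq_zero_or_pos (e 1) with h0 | h0
  · exact ⟨0, zero_le, by rw [h0, mul_zero]⟩
  · exact h.imp fun q hq => ⟨le_of_dvd h0 ⟨e 0, hq.trans (mul_comm _ _)⟩, hq⟩

instance : IsDelta fun e => InCode (f e) (g e) := by
  refine IsDelta.comp₂ f g (P := fun a b => InCode a b) ?_
  exact (inferInstance : IsDelta fun e : ℕ → M => ∃ b, b ≤ e 0 ∧ ∃ m, m ≤ e 0 ∧ ∃ n, n ≤ e 0 ∧
    e 0 = pair b (pair m n) ∧ e 1 < b ∧ modulus m (e 1) ∣ n).congr fun e =>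
      exists_eq_triple_iff (P := fun b m n => e 1 < b ∧ modulus m (e 1) ∣ n)

instance : IsDelta fun e => IsTriple (f e) := by
  refine IsDelta.comp₁ f (P := fun a => IsTriple a) ?_
  exact (inferInstance : IsDelta fun e : ℕ → M => ∃ b, b ≤ e 0 ∧ ∃ m, m ≤ e 0 ∧
    ∃ n, n ≤ e 0 ∧ e 0 = pair b (pair m n)).congr fun e => by
      simpa only [IsTriple, and_true] using
        exists_eq_triple_iff (c := e 0) (P := fun _ _ _ => True)

instance : IsDelta fun e => IsFinSetCode (f e) := by
  refine IsDelta.comp₁ f (P := fun a => IsFinSetCode a) ?_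
  refine (inferInstance : IsDelta fun e : ℕ → M => IsTriple (e 0) ∧
    ∀ c, c < e 0 → IsTriple c → ¬ ∀ x, x < e 0 → (InCode c x ↔ InCode (e 0) x)).congr
    fun e => and_congr_right fun _ => forall₂_congr fun c hc => imp_congr_right fun _ =>
      not_congr ⟨fun h x _ => h x, fun h x => ?_⟩
  by_cases hx : x < e 0
  · exact h x hx
  · exact ⟨fun h' => (hx (h'.lt.trans hc)).elim, fun h' => (hx h'.lt).elim⟩

instance : IsDelta fun e => IsSeq (f e) (g e) := by
  refine IsDelta.comp₂ f g (P := fun a b => IsSeq a b) ?_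
  refine (inferInstance : IsDelta fun e : ℕ → M => IsFinSetCode (e 0) ∧
    (∀ x, x < e 0 → InCode (e 0) x → ∃ i, i ≤ x ∧ ∃ j, j ≤ x ∧ i < e 1 ∧ x = pair i j) ∧
    ∀ i, i < e 1 → ∃ j, j < e 0 ∧ InCode (e 0) (pair i j) ∧
      ∀ j', j' < e 0 → InCode (e 0) (pair i j') → j' = j).congr
    fun e => and_congr_right fun _ => and_congr ⟨fun h x _ hx => ?_, fun h x hx => ?_⟩
      (forall₂_congr fun i _ => ⟨?_, ?_⟩)
  · obtain ⟨i, j, hi, rfl⟩ := h x hx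
    exact ⟨i, left_le_pair _ _, j, right_le_pair _ _, hi, rfl⟩
  · obtain ⟨i, _, j, _, hi, hx⟩ := h x hx.lt hx
    exact ⟨i, j, hi, hx⟩
  · rintro ⟨j, hj, hu⟩
    exact ⟨j, hj.right_lt, hj, fun j' _ h => hu j' h⟩
  · rintro ⟨j, _, hj, hu⟩
    exact ⟨j, hj, fun j' h => hu j' h.right_lt h⟩

end Definability

theorem exists_common_multiple (F : M → M) [hF : IsFn fun e => F (e 0)] (hpos : ∀ x, 0 < F x)
    (b : M) : ∃ N, 0 < N ∧ ∀ x, x < b → F x ∣ N := by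
  have (f : (ℕ → M) → M) [IsFn f] : IsFn fun e => F (f e) := IsFn.comp₁ f hF
  refine sigma_induction (fun b => ∃ N, 0 < N ∧ ∀ x, x < b → F x ∣ N)
    ⟨1, one_pos, fun x hx => absurd hx not_lt_zero⟩ ?_ b
  rintro b ⟨N, hN, h⟩
  refine ⟨N * F b, mul_pos hN (hpos b), fun x hx => ?_⟩
  rcases (Order.lt_add_one_iff.1 hx).lt_or_eq with hx | rfl
  · exact (h x hx).mul_right _
  · exact dvd_mul_left _ _

theorem IsTriple.exists_isFinSetCode {c : M} (hc : IsTriple c) :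
    ∃ d, d ≤ c ∧ IsFinSetCode d ∧ ∀ x, InCode d x ↔ InCode c x := by
  obtain ⟨d, ⟨hd, hdc⟩, hmin⟩ := exists_least
    (fun d => IsTriple d ∧ ∀ x, x < c → (InCode d x ↔ InCode c x)) ⟨hc, fun _ _ => Iff.rfl⟩
  have hle : d ≤ c := not_lt.1 fun hlt => hmin c hlt ⟨hc, fun _ _ => Iff.rfl⟩
  have hdc' : ∀ x, InCode d x ↔ InCode c x := fun x =>
    ⟨fun h => (hdc x (h.lt.trans_le hle)).1 h, fun h => (hdc x h.lt).2 h⟩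
  exact ⟨d, hle, ⟨hd, fun c' hc' ht h => hmin c' hc' ⟨ht, fun x _ => (h x).trans (hdc' x)⟩⟩, hdc'⟩

/-- `n` is the stage `c` of the construction of a number that is divisible by the moduli of exactly
those `x < b` that satisfy `P`: the moduli of the `x < c` have been dealt with, and `r` is a reserve
of moduli for the rest. -/
structure IsCodeStage (P : M → Prop) (b m c n r : M) : Prop where
  modulus_dvd_iff : ∀ x, x < b → (modulus m x ∣ n ↔ x < c ∧ P x)
  modulus_dvd : ∀ x, x < b → c ≤ x → modulus m x ∣ r

section

variable {P : M → Prop} {b m c n r : M}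

theorem IsCodeStage.mul_modulus (hm : ∀ j, j < b → j + 1 ∣ m) (hcb : c < b) (hc : P c)
    (h : IsCodeStage P b m c n (modulus m c * r)) :
    IsCodeStage P b m (c + 1) (n * modulus m c) r where
  modulus_dvd_iff x hx := by
    rcases eq_or_ne x c with rfl | hxc
    · exact ⟨fun _ => ⟨lt_add_one x, hc⟩, fun _ => dvd_mul_left _ _⟩
    · have : modulus m x ∣ n * modulus m c ↔ modulus m x ∣ n :=
        ⟨dvd_of_modulus_dvd_mul hm hx hcb hxc, fun h => h.mul_right _⟩
      rw [this, h.modulus_dvd_iff x hx, Order.lt_add_one_iff, hxc.le_iff_lt]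
  modulus_dvd x hx hcx := by
    have hcx : c < x := Order.add_one_le_iff.1 hcx
    refine dvd_of_modulus_dvd_mul hm hx hcb hcx.ne' ?_
    rw [mul_comm]
    exact h.modulus_dvd x hx hcx.le

theorem IsCodeStage.succ_of_not (hc : ¬ P c) (h : IsCodeStage P b m c n r) :
    IsCodeStage P b m (c + 1) n r where
  modulus_dvd_iff x hx := by
    rw [h.modulus_dvd_iff x hx, Order.lt_add_one_iff]
    exact ⟨fun hxc => ⟨hxc.1.le, hxc.2⟩, fun hxc => ⟨hxc.1.lt_of_ne fun h => hc (h ▸ hxc.2), hxc.2⟩⟩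
  modulus_dvd x hx hcx := h.modulus_dvd x hx ((lt_add_one c).le.trans hcx)

theorem exists_dvd_forall_modulus_dvd_iff [hP : IsDelta fun e => P (e 0)] {N : M} (h0 : 0 < m)
    (hm : ∀ j, j < b → j + 1 ∣ m) (hN : ∀ x, x < b → modulus m x ∣ N) :
    ∃ n, n ∣ N ∧ ∀ x, x < b → (modulus m x ∣ n ↔ P x) := by
  have (f : (ℕ → M) → M) [IsFn f] : IsDelta fun e => P (f e) := hP.comp₁ f
  have : IsSigma fun e : ℕ → M => e 0 ≤ b → ∃ n r, N = n * r ∧ IsCodeStage P b m (e 0) n r :=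
    (inferInstance : IsSigma fun e : ℕ → M => e 0 ≤ b → ∃ n r, N = n * r ∧
      (∀ x, x < b → (modulus m x ∣ n ↔ x < e 0 ∧ P x)) ∧
      ∀ x, x < b → e 0 ≤ x → modulus m x ∣ r).congr fun e =>
        forall_congr' fun _ => exists₂_congr fun _ _ => and_congr_right fun _ =>
          ⟨fun h => ⟨h.1, h.2⟩, fun h => ⟨h.1, h.2⟩⟩
  have stages := sigma_induction
    (fun c => c ≤ b → ∃ n r, N = n * r ∧ IsCodeStage P b m c n r)
    (fun _ => ⟨1, N, (one_mul N).symm, fun x _ => iff_of_false (not_modulus_dvd_one h0 x)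
      fun h => not_lt_zero h.1, fun x hx _ => hN x hx⟩) fun c ih hc => by
    have hcb : c < b := Order.add_one_le_iff.1 hc
    obtain ⟨n, r, hnr, h⟩ := ih hcb.le
    by_cases hPc : P c
    · obtain ⟨r', rfl⟩ := h.modulus_dvd c hcb le_rfl
      exact ⟨_, r', hnr.trans (mul_assoc _ _ _).symm, h.mul_modulus hm hcb hPc⟩
    · exact ⟨n, r, hnr, h.succ_of_not hPc⟩
  obtain ⟨n, r, hnr, h⟩ := stages b le_rfl
  exact ⟨n, ⟨r, hnr⟩, fun x hx => (h.modulus_dvd_iff x hx).trans (and_iff_right hx)⟩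

end

/-- `B` bounds the codes of all subsets of `{0, …, b - 1}` that use a multiplier `m` and a number
divisible by all moduli as in this definition. -/
def IsCodeBound (b B : M) : Prop :=
  ∃ m, m < B ∧ ∃ N, N < B ∧ B = pair b (pair m N) + 1 ∧ 0 < m ∧ 0 < N ∧
    (∀ j, j < b → j + 1 ∣ m) ∧ ∀ x, x < b → modulus m x ∣ N

instance (f g : (ℕ → M) → M) [IsFn f] [IsFn g] : IsDelta fun e => IsCodeBound (f e) (g e) :=
  IsDelta.comp₂ f g (P := fun a b => IsCodeBound a b) (by unfold IsCodeBound; infer_instance)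

theorem exists_isCodeBound (b : M) : ∃ B, IsCodeBound b B := by
  obtain ⟨m, hm, hmd⟩ := exists_common_multiple (fun x : M => x + (1 : M))
    (fun x => by positivity) b
  obtain ⟨N, hN, hNd⟩ :=
    exists_common_multiple (fun x => modulus m x) (fun x => by unfold modulus; positivity) b
  have h := right_le_pair b (pair m N)
  exact ⟨pair b (pair m N) + 1, m, Order.lt_add_one_iff.2 ((left_le_pair _ _).trans h), N,
    Order.lt_add_one_iff.2 ((right_le_pair _ _).trans h), rfl, hm, hN, hmd, hNd⟩

theorem IsCodeBound.exists_code {b B : M} (hB : IsCodeBound b B) (P : M → Prop)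
    [IsDelta fun e => P (e 0)] :
    ∃ c, c < B ∧ IsFinSetCode c ∧ ∀ x, InCode c x ↔ x < b ∧ P x := by
  obtain ⟨m, -, N, -, rfl, hm, hN, hmd, hNd⟩ := hB
  obtain ⟨n, hnN, hn⟩ := exists_dvd_forall_modulus_dvd_iff (P := P) hm hmd hNd
  obtain ⟨c, hc, hfc, hce⟩ := IsTriple.exists_isFinSetCode ⟨b, m, n, rfl⟩
  refine ⟨c, Order.lt_add_one_iff.2 (hc.trans ?_), hfc, fun x => ?_⟩
  · have : n ≤ N := le_of_dvd hN hnN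
    unfold pair
    gcongr
  · rw [hce, inCode_pair]
    exact and_congr_right fun hx => hn x hx

end FiniteSets

section Sequences

variable {M : Type u} [NumStructure M]

/-- Inclusion between the finite sets given by `c` and `d`; for sequences, `c` is an initial segment
of `d`. -/
def CodeSubset (c d : M) : Prop := ∀ x, InCode c x → InCode d x

theorem IsSeq.exists_value {s l i : M} (h : IsSeq s l) (hi : i < l) : ∃ j, InCode s (pair i j) :=
  (h.2.2 i hi).exists

theorem IsSeq.forall_inCode {s l : M} (hs : IsSeq s l) {P : M → Prop}
    (h : ∀ i j, InCode s (pair i j) → P (pair i j)) (x : M) (hx : InCode s x) : P x := by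
  obtain ⟨i, j, -, rfl⟩ := hs.2.1 x hx
  exact h i j hx

variable [RCA0Model M]

theorem IsSeq.lt_length {s l i j : M} (h : IsSeq s l) (hij : InCode s (pair i j)) : i < l := by
  obtain ⟨i', j', hi, he⟩ := h.2.1 _ hij
  exact (pair_inj.1 he).1 ▸ hi

theorem IsSeq.value_unique {s l i j j' : M} (h : IsSeq s l) (hj : InCode s (pair i j))
    (hj' : InCode s (pair i j')) : j = j' :=
  (h.2.2 i (h.lt_length hj)).unique hj hj'

theorem IsSeq.length_le {s l : M} (h : IsSeq s l) : l ≤ s := by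
  by_contra! hlt
  obtain ⟨j, hj⟩ := h.exists_value hlt
  exact hj.left_lt.false

theorem IsSeq.length_le_of_codeSubset {s t l m : M} (hs : IsSeq s l) (ht : IsSeq t m)
    (h : CodeSubset s t) : l ≤ m := by
  by_contra! hlt
  obtain ⟨j, hj⟩ := hs.exists_value hlt
  exact (ht.lt_length (h _ hj)).false

theorem IsSeq.length_unique {s l m : M} (hs : IsSeq s l) (ht : IsSeq s m) : l = m :=
  le_antisymm (hs.length_le_of_codeSubset ht fun _ h => h)
    (ht.length_le_of_codeSubset hs fun _ h => h)

theorem IsSeq.inCode_of_codeSubset {s t l m i j : M} (hs : IsSeq s l) (ht : IsSeq t m)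
    (h : CodeSubset s t) (hi : i < l) (hij : InCode t (pair i j)) : InCode s (pair i j) := by
  obtain ⟨j', hj'⟩ := hs.exists_value hi
  rwa [ht.value_unique hij (h _ hj')]

instance (f g : (ℕ → M) → M) [IsFn f] [IsFn g] : IsDelta fun e => CodeSubset (f e) (g e) := by
  refine IsDelta.comp₂ f g (P := fun a b => CodeSubset a b) ?_
  exact (inferInstance : IsDelta fun e : ℕ → M => ∀ x, x < e 0 → InCode (e 0) x →
    InCode (e 1) x).congr fun e => ⟨fun h x _ hx => h x hx, fun h x hx => h x hx.lt hx⟩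

theorem exists_bound (F : M → M) [hF : IsFn fun e => F (e 0)] (l : M) :
    ∃ B, ∀ i, i < l → F i < B := by
  have (f : (ℕ → M) → M) [IsFn f] : IsFn fun e => F (f e) := IsFn.comp₁ f hF
  refine sigma_induction (fun l => ∃ B, ∀ i, i < l → F i < B)
    ⟨0, fun i hi => absurd hi not_lt_zero⟩ ?_ l
  rintro n ⟨B, hB⟩
  refine ⟨max B (F n + 1), fun i hi => ?_⟩
  rcases (Order.lt_add_one_iff.1 hi).lt_or_eq with hi | rfl
  · exact (hB i hi).trans_le (le_max_left _ _)
  · exact (lt_add_one _).trans_le (le_max_right _ _)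

theorem exists_seq (F : M → M) [hF : IsFn fun e => F (e 0)] (l : M) :
    ∃ s, IsSeq s l ∧ ∀ i j, InCode s (pair i j) ↔ i < l ∧ j = F i := by
  have (f : (ℕ → M) → M) [IsFn f] : IsFn fun e => F (f e) := IsFn.comp₁ f hF
  obtain ⟨B, hB⟩ := exists_bound F l
  obtain ⟨_, hN⟩ := exists_isCodeBound (pair l B)
  obtain ⟨s, -, hs, hse⟩ := hN.exists_code fun x => ∃ i, i ≤ x ∧ i < l ∧ x = pair i (F i)
  have hmem : ∀ i j, InCode s (pair i j) ↔ i < l ∧ j = F i := fun i j => by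
    rw [hse]
    refine ⟨?_, ?_⟩
    · rintro ⟨-, i', -, hi', he⟩
      obtain ⟨rfl, rfl⟩ := pair_inj.1 he
      exact ⟨hi', rfl⟩
    · rintro ⟨hi, rfl⟩
      exact ⟨pair_lt_pair_of_add_lt (add_lt_add hi (hB i hi)), i, left_le_pair _ _, hi, rfl⟩
  refine ⟨s, ⟨hs, fun x hx => ?_, fun i hi =>
    ⟨F i, (hmem i _).2 ⟨hi, rfl⟩, fun j hj => ((hmem i j).1 hj).2⟩⟩, hmem⟩
  obtain ⟨-, i, -, hi, he⟩ := (hse x).1 hx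
  exact ⟨i, F i, hi, he⟩

theorem exists_seq_of_forall_exists (R : M → M → Prop) [hR : IsSigma fun e => R (e 0) (e 1)] {l : M}
    (h : ∀ i, i < l → ∃ j, R i j) : ∃ s, IsSeq s l ∧ ∀ i j, InCode s (pair i j) → R i j := by
  have (f g : (ℕ → M) → M) [IsFn f] [IsFn g] : IsSigma fun e => R (f e) (g e) := hR.comp₂ f g
  obtain ⟨F, hF, hFR⟩ := IsSigma.exists_selector (fun e j => e 0 < l → R (e 0) j) fun e => by
    by_cases he : e 0 < l
    · exact (h _ he).imp fun j hj _ => hj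
    · exact ⟨0, fun h => (he h).elim⟩
  have := hF.comp fun e => push (e 0) 0
  obtain ⟨s, hs, hse⟩ := exists_seq (fun i => F (push i 0)) l
  refine ⟨s, hs, fun i j hij => ?_⟩
  obtain ⟨hi, rfl⟩ := (hse i j).1 hij
  exact hFR (push i 0) hi

theorem IsSeq.exists_extension {s l m : M} (hs : IsSeq s l) (hlm : l ≤ m) (R : M → M → Prop)
    [hR : IsSigma fun e => R (e 0) (e 1)] (h : ∀ i, l ≤ i → i < m → ∃ j, R i j) :
    ∃ t, IsSeq t m ∧ CodeSubset s t ∧ ∀ i j, l ≤ i → InCode t (pair i j) → R i j := by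
  have (f g : (ℕ → M) → M) [IsFn f] [IsFn g] : IsSigma fun e => R (f e) (g e) := hR.comp₂ f g
  obtain ⟨t, ht, htR⟩ := exists_seq_of_forall_exists
    (fun i j => InCode s (pair i j) ∨ l ≤ i ∧ R i j) fun i hi => by
      rcases lt_or_ge i l with hil | hli
      · exact (hs.exists_value hil).imp fun _ => Or.inl
      · exact (h i hli hi).imp fun _ hj => Or.inr ⟨hli, hj⟩
  refine ⟨t, ht, hs.forall_inCode (P := InCode t) fun i j hij => ?_, fun i j hi hij => ?_⟩
  · have hi := hs.lt_length hij
    obtain ⟨j', hj'⟩ := ht.exists_value (hi.trans_le hlm)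
    rcases htR i j' hj' with h' | ⟨hli, -⟩
    · rwa [hs.value_unique hij h']
    · exact absurd hi hli.not_gt
  · rcases htR i j hij with h' | ⟨-, h'⟩
    · exact absurd (hs.lt_length h') hi.not_gt
    · exact h'

end Sequences

section Recursion

variable {M : Type u} [NumStructure M]

/-- The sequence `c` lists the values at `0, …, n` of the function `F` that is given by `F 0 = a`
and `F (i + 1) = h i (F i)`. -/
def IsComputation (a : M) (h : M → M → M) (n c : M) : Prop :=
  IsSeq c (n + 1) ∧ InCode c (pair 0 a) ∧
    ∀ i, i < n → ∀ u, InCode c (pair i u) → InCode c (pair (i + 1) (h i u))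

variable [RCA0Model M] {a : M} {h : M → M → M}

theorem IsComputation.value_unique {n m c d : M} (hc : IsComputation a h n c)
    (hd : IsComputation a h m d) (i : M) :
    ∀ u v, InCode c (pair i u) → InCode d (pair i v) → u = v := by
  suffices ∀ u, u < c → ∀ v, v < d → InCode c (pair i u) → InCode d (pair i v) → u = v from
    fun u v hu hv => this u hu.right_lt v hv.right_lt hu hv
  refine sigma_induction (fun i => ∀ u, u < c → ∀ v, v < d →
    InCode c (pair i u) → InCode d (pair i v) → u = v) (fun u _ v _ hu hv => ?_)
    (fun i ih u _ v _ hu hv => ?_) i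
  · rw [hc.1.value_unique hu hc.2.1, hd.1.value_unique hv hd.2.1]
  · have hin := hc.1.lt_length hu
    have him := hd.1.lt_length hv
    obtain ⟨u', hu'⟩ := hc.1.exists_value ((lt_add_one i).trans hin)
    obtain ⟨v', hv'⟩ := hd.1.exists_value ((lt_add_one i).trans him)
    rw [hc.1.value_unique hu (hc.2.2 i (lt_of_add_lt_add_right hin) u' hu'),
      hd.1.value_unique hv (hd.2.2 i (lt_of_add_lt_add_right him) v' hv'),
      ih u' hu'.right_lt v' hv'.right_lt hu' hv']

theorem IsComputation.exists_succ {n c : M} (hc : IsComputation a h n c) :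
    ∃ d, IsComputation a h (n + 1) d := by
  obtain ⟨hs, h0, hsucc⟩ := hc
  obtain ⟨u, hu⟩ := hs.exists_value (lt_add_one n)
  obtain ⟨d, hd, hcd, hdu⟩ := hs.exists_extension (lt_add_one (n + 1)).le (fun _ j => j = h n u)
    fun _ _ _ => ⟨_, rfl⟩
  refine ⟨d, hd, hcd _ h0, fun i hi v hv => ?_⟩
  have hv' : InCode c (pair i v) := hs.inCode_of_codeSubset hd hcd hi hv
  rcases (Order.lt_add_one_iff.1 hi).lt_or_eq with hi | rfl
  · exact hcd _ (hsucc i hi v hv')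
  · obtain ⟨j, hj⟩ := hd.exists_value (lt_add_one (i + 1))
    rwa [hs.value_unique hv' hu, ← hdu _ j le_rfl hj]

variable [hh : IsFn fun e => h (e 0) (e 1)]

instance (f g : (ℕ → M) → M) [IsFn f] [IsFn g] :
    IsDelta fun e => IsComputation a h (f e) (g e) := by
  have (f g : (ℕ → M) → M) [IsFn f] [IsFn g] : IsFn fun e => h (f e) (g e) := IsFn.comp₂ f g hh
  refine IsDelta.comp₂ f g (P := fun n c => IsComputation a h n c) ?_
  exact (inferInstance : IsDelta fun e : ℕ → M => IsSeq (e 1) (e 0 + 1) ∧ InCode (e 1) (pair 0 a) ∧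
    ∀ i, i < e 0 → ∀ u, u < e 1 → InCode (e 1) (pair i u) →
      InCode (e 1) (pair (i + 1) (h i u))).congr fun e =>
    and_congr_right fun _ => and_congr_right fun _ => forall₂_congr fun i _ =>
      ⟨fun H u _ => H u, fun H u hu => H u hu.right_lt hu⟩

theorem exists_isComputation (n : M) : ∃ c, IsComputation a h n c := by
  refine sigma_induction (fun n => ∃ c, IsComputation a h n c) ?_
    (fun n ⟨c, hc⟩ => hc.exists_succ) n
  obtain ⟨c, hc, hca⟩ := exists_seq (fun _ => a) (0 + 1)
  exact ⟨c, hc, (hca _ _).2 ⟨lt_add_one 0, rfl⟩, fun i hi => absurd hi not_lt_zero⟩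

variable (a h) in
theorem exists_recursion :
    ∃ F : M → M, IsFn (fun e => F (e 0)) ∧ F 0 = a ∧ ∀ n, F (n + 1) = h n (F n) := by
  choose c hc using exists_isComputation (a := a) (h := h)
  choose F hF using fun n => (hc n).1.exists_value (lt_add_one n)
  refine ⟨F, ⟨?_⟩, (hc 0).1.value_unique (hF 0) (hc 0).2.1, fun n => ?_⟩
  · refine (inferInstance : IsSigma fun e : ℕ → M =>
      ∃ c, IsComputation a h (e 1) c ∧ InCode c (pair (e 1) (e 0))).congr fun e =>
        ⟨fun he => ⟨c (e 1), hc _, ?_⟩, fun ⟨d, hd, hv⟩ => hd.value_unique (hc _) _ _ _ hv (hF _)⟩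
    rw [he]
    exact hF _
  · obtain ⟨u, hu⟩ := (hc (n + 1)).1.exists_value ((lt_add_one n).trans (lt_add_one _))
    rw [(hc n).value_unique (hc (n + 1)) n _ u (hF n) hu]
    exact (hc (n + 1)).1.value_unique (hF (n + 1)) ((hc (n + 1)).2.2 n (lt_add_one n) u hu)

end Recursion

theorem exists_dependent_choice {M : Type u} [NumStructure M] [RCA0Model M] (V : M → M → Prop)
    (R : M → M → M → Prop) [hV : IsDelta fun e => V (e 0) (e 1)]
    [hR : IsSigma fun e => R (e 0) (e 1) (e 2)] {a : M} (h0 : V 0 a)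
    (h1 : ∀ n y, V n y → ∃ z, V (n + 1) z ∧ R n y z) :
    ∃ F : M → M, IsFn (fun e => F (e 0)) ∧ (∀ n, V n (F n)) ∧ ∀ n, R n (F n) (F (n + 1)) := by
  have (f g : (ℕ → M) → M) [IsFn f] [IsFn g] : IsDelta fun e => V (f e) (g e) := hV.comp₂ f g
  have (f g k : (ℕ → M) → M) [IsFn f] [IsFn g] [IsFn k] : IsSigma fun e => R (f e) (g e) (k e) :=
    hR.comp₃ f g k
  obtain ⟨next, hnext, hVR⟩ := IsSigma.exists_selector
    (fun e z => V (e 0) (e 1) → V (e 0 + (1 : M)) z ∧ R (e 0) (e 1) z) fun e => by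
      by_cases he : V (e 0) (e 1)
      · exact (h1 _ _ he).imp fun z hz _ => hz
      · exact ⟨0, fun h => (he h).elim⟩
  have := hnext.comp fun e => push (e 0) (push (e 1) 0)
  obtain ⟨F, hF, hF0, hFs⟩ := exists_recursion a fun n y => next (push n (push y 0))
  have (f : (ℕ → M) → M) [IsFn f] : IsFn fun e => F (f e) := IsFn.comp₁ f hF
  have hVF : ∀ n, V n (F n) := sigma_induction (fun n => V n (F n)) (hF0 ▸ h0) fun n hn => by
    rw [hFs]
    exact (hVR (push n (push (F n) 0)) hn).1
  refine ⟨F, hF, hVF, fun n => ?_⟩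
  rw [hFs]
  exact (hVR (push n (push (F n) 0)) (hVF n)).2

section Partitions

variable {M : Type u} [NumStructure M]

/-- `y` codes an ordered finite sequence whose set of values is `{0, …, b - 1}`, where `b` may be
nonstandard. -/
structure IsOrderedSeq (b y : M) : Prop where
  exists_length : ∃ l, IsSeq y l
  value_lt : ∀ ⦃n i⦄, InCode y (pair n i) → i < b
  isOrdered : IsOrdered {x | InCode y x}
  exists_position : ∀ i, i < b → ∃ n, InCode y (pair n i)

theorem isFinPartition_iff {k : ℕ} {s : M} : IsFinPartition k s ↔ IsOrderedSeq (numeral M k) s :=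
  ⟨fun ⟨hl, hlt, ho, hs⟩ => ⟨hl, hlt, ho, hs⟩, fun ⟨hl, hlt, ho, hs⟩ => ⟨hl, hlt, ho, hs⟩⟩

theorem IsFun.exists_value {f : Set M} (hf : IsFun f) (i : M) : ∃ j, pair i j ∈ f :=
  (hf.2 i).exists

theorem IsFun.value_unique {f : Set M} (hf : IsFun f) {i j j' : M} (h : pair i j ∈ f)
    (h' : pair i j' ∈ f) : j = j' :=
  (hf.2 i).unique h h'

variable [RCA0Model M]

instance (f g : (ℕ → M) → M) [IsFn f] [IsFn g] : IsDelta fun e => IsOrderedSeq (f e) (g e) := by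
  refine IsDelta.comp₂ f g (P := fun a b => IsOrderedSeq a b) ?_
  refine (inferInstance : IsDelta fun e : ℕ → M => (∃ l, l ≤ e 1 ∧ IsSeq (e 1) l) ∧
    (∀ n, n < e 1 → ∀ i, i < e 1 → InCode (e 1) (pair n i) → i < e 0) ∧
    (∀ n, n < e 1 → ∀ i, i < e 1 → InCode (e 1) (pair n i) → ∀ j, j < i → ∃ m, m < n ∧
      InCode (e 1) (pair m j)) ∧
    ∀ i, i < e 0 → ∃ n, n < e 1 ∧ InCode (e 1) (pair n i)).congr fun e => ⟨?_, ?_⟩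
  · rintro ⟨⟨l, hl⟩, hlt, ho, hs⟩
    exact ⟨⟨l, hl.length_le, hl⟩, fun n _ i _ h => hlt h, fun n _ i _ => ho n i,
      fun i hi => (hs i hi).imp fun n hn => ⟨hn.left_lt, hn⟩⟩
  · rintro ⟨⟨l, -, hl⟩, hlt, ho, hs⟩
    exact ⟨⟨l, hl⟩, fun n i h => hlt n h.left_lt i h.right_lt h,
      fun n i (h : InCode (e 1) _) => ho n h.left_lt i h.right_lt h,
      fun i hi => (hs i hi).imp fun n => And.right⟩

instance (k : ℕ) (f : (ℕ → M) → M) [IsFn f] : IsDelta fun e => IsFinPartition k (f e) :=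
  (inferInstance : IsDelta fun e => IsOrderedSeq (numeral M k) (f e)).congr
    fun _ => isFinPartition_iff

theorem exists_set_of_pairs (R : M → M → Prop) [hR : IsDelta fun e => R (e 0) (e 1)] :
    ∃ X ∈ sets, (∀ z ∈ X, ∃ i j, z = pair i j) ∧ ∀ i j : M, pair i j ∈ X ↔ R i j := by
  have (f g : (ℕ → M) → M) [IsFn f] [IsFn g] : IsDelta fun e => R (f e) (g e) := hR.comp₂ f g
  refine ⟨_, delta_comprehension fun z => ∃ i, i ≤ z ∧ ∃ j, j ≤ z ∧ z = pair i j ∧ R i j,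
    fun z ⟨i, _, j, _, hz, _⟩ => ⟨i, j, hz⟩, fun i j => ⟨?_, fun h =>
      ⟨i, left_le_pair _ _, j, right_le_pair _ _, rfl, h⟩⟩⟩
  rintro ⟨i', -, j', -, he, h⟩
  obtain ⟨rfl, rfl⟩ := pair_inj.1 he
  exact h

theorem IsSigma.isDelta_of_existsUnique {R : M → M → Prop}
    (h : IsSigma fun e => R (e 0) (e 1)) (hR : ∀ n, ∃! a, R n a) :
    IsDelta fun e => R (e 0) (e 1) := by
  have (f g : (ℕ → M) → M) [IsFn f] [IsFn g] : IsSigma fun e => R (f e) (g e) := h.comp₂ f g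
  refine ⟨h, (inferInstance : IsSigma fun e : ℕ → M => ∃ a, R (e 0) a ∧ a ≠ e 1).congr
    fun e => ⟨fun hna => ?_, fun ⟨b, hb, hne⟩ ha => hne ((hR _).unique hb ha)⟩⟩
  obtain ⟨b, hb⟩ := (hR (e 0)).exists
  exact ⟨b, hb, fun hba => hna (hba ▸ hb)⟩

theorem exists_graph (R : M → M → Prop) [h : IsSigma fun e => R (e 0) (e 1)]
    (hR : ∀ n, ∃! a, R n a) : ∃ f ∈ sets, IsFun f ∧ ∀ n a : M, pair n a ∈ f ↔ R n a := by
  have := h.isDelta_of_existsUnique hR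
  obtain ⟨f, hf, hpairs, hmem⟩ := exists_set_of_pairs R
  exact ⟨f, hf, ⟨hpairs, fun n => by simpa only [hmem] using hR n⟩, hmem⟩

section Restriction

variable {x : Set M} {l s b : M}

theorem exists_restriction (hxs : x ∈ sets) (hx : IsFun x) (l : M) :
    ∃ s, IsRestriction x l s := by
  have := Fact.mk hxs
  obtain ⟨s, hs, h⟩ := exists_seq_of_forall_exists (fun i j => pair i j ∈ x)
    (fun i (_ : i < l) => hx.exists_value i)
  exact ⟨s, hs, hs.forall_inCode (P := (· ∈ x)) h⟩

theorem IsRestriction.inCode_iff (hx : IsFun x) (hs : IsRestriction x l s) {i j : M} :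
    InCode s (pair i j) ↔ i < l ∧ pair i j ∈ x := by
  refine ⟨fun h => ⟨hs.1.lt_length h, hs.2 _ h⟩, fun ⟨hi, hij⟩ => ?_⟩
  obtain ⟨j', hj'⟩ := hs.1.exists_value hi
  rwa [hx.value_unique hij (hs.2 _ hj')]

theorem IsRestriction.codeSubset (hx : IsFun x) {m t : M} (hs : IsRestriction x l s)
    (ht : IsRestriction x m t) (hlm : l ≤ m) : CodeSubset s t :=
  hs.1.forall_inCode (P := InCode t) fun _ _ h =>
    (ht.inCode_iff hx).2 ⟨(hs.1.lt_length h).trans_le hlm, hs.2 _ h⟩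

theorem IsRestriction.comparable (hx : IsFun x) {m t : M} (hs : IsRestriction x l s)
    (ht : IsRestriction x m t) : Comparable s t :=
  (le_total l m).imp (hs.codeSubset hx ht) (ht.codeSubset hx hs)

theorem IsRestriction.isOrderedSeq (hx : IsFun x) (ho : IsOrdered x) (hs : IsRestriction x l s)
    (hlt : ∀ n i, n < l → pair n i ∈ x → i < b)
    (hsurj : ∀ i, i < b → ∃ n, n < l ∧ pair n i ∈ x) : IsOrderedSeq b s where
  exists_length := ⟨l, hs.1⟩
  value_lt n i h := hlt n i (hs.1.lt_length h) (hs.2 _ h)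
  isOrdered n i h j hj := by
    have hnl := hs.1.lt_length h
    obtain ⟨m, hm, hmj⟩ := ho n i (hs.2 _ h) j hj
    exact ⟨m, hm, (hs.inCode_iff hx).2 ⟨hm.trans hnl, hmj⟩⟩
  exists_position i hi := (hsurj i hi).imp fun _ => (hs.inCode_iff hx).2

variable {k : ℕ} (hx : IsPartition (k + 1) x)
include hx

theorem IsPartition.isFinPartition_restriction {m : M} (hm : pair m (numeral M k) ∈ x)
    (hml : m < l) (hs : IsRestriction x l s) : IsFinPartition (k + 1) s := by
  obtain ⟨hf, hlt, ho, -⟩ := hx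
  refine isFinPartition_iff.2 (hs.isOrderedSeq hf ho (fun n i _ => hlt n i) fun i hi => ?_)
  rcases (Order.lt_add_one_iff.1 hi).lt_or_eq with hi | rfl
  · obtain ⟨n, hn, h⟩ := ho m _ hm i hi
    exact ⟨n, hn.trans hml, h⟩
  · exact ⟨m, hml, hm⟩

theorem IsPartition.isFinPartition_restriction_mu (hl : IsMu x (numeral M k) l)
    (hs : IsRestriction x l s) : IsFinPartition k s := by
  obtain ⟨hf, hlt, ho, -⟩ := hx
  refine isFinPartition_iff.2 (hs.isOrderedSeq hf ho (fun n i hn hni => ?_) (ho l _ hl.1))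
  refine (Order.lt_add_one_iff.1 (hlt n i hni)).lt_of_ne ?_
  rintro rfl
  exact hl.2 n hn hni

theorem IsPartition.exists_isMu (hxs : x ∈ sets) : ∃ m, IsMu x (numeral M k) m := by
  have := Fact.mk hxs
  obtain ⟨n, hn⟩ := hx.2.2.2 (numeral M k) (lt_add_one _)
  exact exists_least (fun m => pair m (numeral M k) ∈ x) hn

end Restriction

section OpenCodes

variable {k : ℕ} {O D : Set M}

theorem isOpenSeqCode_iff : IsOpenSeqCode k D ↔
    (∀ z ∈ D, ∃ i w, z = pair i w) ∧ ∀ i, IsOpenCode k (openSection D i) := by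
  refine ⟨fun h => ⟨fun z hz => ?_, fun i w hw => ?_⟩, fun h z hz => ?_⟩
  · obtain ⟨i, n, s, rfl, -⟩ := h z hz
    exact ⟨i, _, rfl⟩
  · obtain ⟨i', n, s, he, hs⟩ := h _ hw
    exact ⟨n, s, (pair_inj.1 he).2, hs⟩
  · obtain ⟨i, w, rfl⟩ := h.1 z hz
    obtain ⟨n, s, rfl, hs⟩ := h.2 i w hz
    exact ⟨i, n, s, rfl, hs⟩

theorem IsOpenCode.isFinPartition (hO : IsOpenCode k O) {n s : M} (h : pair n s ∈ O) :
    IsFinPartition k s := by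
  obtain ⟨n', s', he, hs⟩ := hO _ h
  rwa [(pair_inj.1 he).2]

theorem exists_isOpenSeqCode (R : M → M → Prop) [IsDelta fun e => R (e 0) (e 1)]
    (hR : ∀ i, IsOpenCode k {w | R i w}) :
    ∃ D ∈ sets, IsOpenSeqCode k D ∧ ∀ i : M, openSection D i = {w | R i w} := by
  obtain ⟨D, hD, hpairs, hmem⟩ := exists_set_of_pairs R
  have hsec (i : M) : openSection D i = {w | R i w} := Set.ext (hmem i)
  exact ⟨D, hD, isOpenSeqCode_iff.2 ⟨hpairs, fun i => by rw [hsec]; exact hR i⟩, hsec⟩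

theorem IsFinPartition.exists_isPartition {t : M} (ht : IsFinPartition (k + 1) t) :
    ∃ x ∈ sets, IsPartition (k + 1) x ∧ IsPrefix t x := by
  obtain ⟨⟨l, hl⟩, hlt, ho, hs⟩ := ht
  obtain ⟨x, hxs, hxf, hx⟩ := exists_graph (fun n a => InCode t (pair n a) ∨ l ≤ n ∧ a = 0)
    fun n => by
      rcases lt_or_ge n l with hn | hn
      · obtain ⟨j, hj⟩ := hl.exists_value hn
        exact ⟨j, Or.inl hj, fun j' h => h.elim (fun h => hl.value_unique h hj)
          fun h => absurd hn h.1.not_gt⟩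
      · exact ⟨0, Or.inr ⟨hn, rfl⟩, fun j' h => h.elim
          (fun h => absurd (hl.lt_length h) hn.not_gt) And.right⟩
  have htx : ∀ i j, InCode t (pair i j) → pair i j ∈ x := fun i j h => (hx i j).2 (Or.inl h)
  refine ⟨x, hxs, ⟨hxf, fun n i hni => ?_, fun n i hni j hj => ?_,
    fun i hi => (hs i hi).imp fun n => htx n i⟩, hl.forall_inCode (P := (· ∈ x)) htx⟩
  · rcases (hx n i).1 hni with h | ⟨-, rfl⟩
    · exact hlt n i h
    · exact add_pos_of_nonneg_of_pos zero_le one_pos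
  · rcases (hx n i).1 hni with h | ⟨-, rfl⟩
    · exact (ho n i h j hj).imp fun m hm => ⟨hm.1, htx m j hm.2⟩
    · exact absurd hj not_lt_zero

theorem IsOpenColoring.isDenseCode_iUnion {ℓ : ℕ} {O : Fin ℓ → Set M}
    (hO : IsOpenColoring sets (k + 1) O) : IsDenseCode (k + 1) (⋃ i, O i) := by
  intro t ht
  obtain ⟨x, hxs, hx, htx⟩ := ht.exists_isPartition
  obtain ⟨i, n, s, hns, hsx⟩ := hO.2 x hxs hx
  obtain ⟨l, hl⟩ := ht.1
  obtain ⟨m, hm⟩ := ((hO.1 i).isFinPartition hns).1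
  exact ⟨n, s, Set.mem_iUnion.2 ⟨i, hns⟩, IsRestriction.comparable hx.1 ⟨hm, hsx⟩ ⟨hl, htx⟩⟩

end OpenCodes

theorem BaireDRT.odrt {k ℓ : ℕ} (h : BaireDRT (sets : Set (Set M)) (k + 1) ℓ) :
    ODRT (sets : Set (Set M)) (k + 1) ℓ := by
  intro O hOs hO
  have (i : Fin ℓ) := Fact.mk (hOs i)
  obtain ⟨D, hDs, hD, hsec⟩ := exists_isOpenSeqCode (k := k + 1) (fun _ w => ∃ j, w ∈ O j)
    fun _ w ⟨j, hj⟩ => hO.1 j w hj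
  have hdense := hO.isDenseCode_iUnion
  obtain ⟨p, hps, hp, i, hpi⟩ := h O D hOs hDs
    ⟨hD, fun n => by rwa [hsec, Set.ofPred_exists], hO.1, hdense⟩
  exact ⟨p, hps, hp, i, fun x hxs hx => (hpi x hxs hx).1⟩

/-- The string `s` of length `l + 1` is the string `t` of length `l` followed by the value `b`. -/
structure IsSnoc (t l b s : M) : Prop where
  isSeq_init : IsSeq t l
  isSeq : IsSeq s (l + 1)
  codeSubset : CodeSubset t s
  inCode : InCode s (pair l b)

instance (f g h k : (ℕ → M) → M) [IsFn f] [IsFn g] [IsFn h] [IsFn k] :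
    IsDelta fun e => IsSnoc (f e) (g e) (h e) (k e) :=
  (inferInstance : IsDelta fun e => IsSeq (f e) (g e) ∧ IsSeq (k e) (g e + (1 : M)) ∧
    CodeSubset (f e) (k e) ∧ InCode (k e) (pair (g e) (h e))).congr fun _ =>
      ⟨fun h => ⟨h.1, h.2, h.3, h.4⟩, fun h => ⟨h.1, h.2.1, h.2.2.1, h.2.2.2⟩⟩

theorem IsSnoc.isPrefix {t l b s : M} {x : Set M} (h : IsSnoc t l b s) (ht : IsPrefix t x)
    (hb : pair l b ∈ x) : IsPrefix s x :=
  h.isSeq.forall_inCode (P := (· ∈ x)) fun i j hij => by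
    rcases (Order.lt_add_one_iff.1 (h.isSeq.lt_length hij)).lt_or_eq with hi | rfl
    · obtain ⟨j', hj'⟩ := h.isSeq_init.exists_value hi
      rw [h.isSeq.value_unique hij (h.codeSubset _ hj')]
      exact ht _ hj'
    · rwa [h.isSeq.value_unique hij h.inCode]

theorem IsRestriction.isSnoc {t l b s : M} {x : Set M} (hx : IsFun x) (ht : IsRestriction x l t)
    (hs : IsRestriction x (l + 1) s) (hb : pair l b ∈ x) : IsSnoc t l b s where
  isSeq_init := ht.1
  isSeq := hs.1
  codeSubset := ht.codeSubset hx hs (lt_add_one l).le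
  inCode := (hs.inCode_iff hx).2 ⟨lt_add_one l, hb⟩

theorem IsFinPartition.isMu {k : ℕ} {t l : M} {x : Set M} (ht : IsFinPartition k t) (hx : IsFun x)
    (htx : IsRestriction x l t) (hl : pair l (numeral M k) ∈ x) : IsMu x (numeral M k) l := by
  refine ⟨hl, fun m hm hmx => lt_irrefl (numeral M k) ?_⟩
  exact (isFinPartition_iff.1 ht).value_lt ((htx.inCode_iff hx).2 ⟨hm, hmx⟩)

theorem ODRT.cdrt {k ℓ : ℕ} (h : ODRT (sets : Set (Set M)) (k + 1) ℓ) :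
    CDRT (sets : Set (Set M)) (k + 1) ℓ := by
  intro C hCs hC
  have (i : Fin ℓ) := Fact.mk (hCs i)
  choose O hOs hpairs hO using fun c : Fin ℓ => exists_set_of_pairs fun t s : M =>
    t ∈ C c ∧ IsFinPartition (k + (1 : ℕ)) s ∧ ∃ l, l ≤ t ∧ IsSnoc t l (numeral M k) s
  have hcol : IsOpenColoring sets (k + 1) O := by
    refine ⟨fun c z hz => ?_, fun x hxs hx => ?_⟩
    · obtain ⟨t, s, rfl⟩ := hpairs c z hz
      exact ⟨t, s, rfl, ((hO c t s).1 hz).2.1⟩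
    · obtain ⟨m, hm⟩ := hx.exists_isMu hxs
      obtain ⟨t, ht⟩ := exists_restriction hxs hx.1 m
      obtain ⟨s, hs⟩ := exists_restriction hxs hx.1 (m + 1)
      obtain ⟨c, hc⟩ := hC.2 t (hx.isFinPartition_restriction_mu hm ht)
      exact ⟨c, t, s, (hO c t s).2 ⟨hc, hx.isFinPartition_restriction hm.1 (lt_add_one m) hs, m,
        ht.1.length_le, ht.isSnoc hx.1 hs hm.1⟩, hs.2⟩
  obtain ⟨p, hps, hp, c, hpc⟩ := h O hOs hcol
  refine ⟨p, hps, hp, c, fun x hxs hx => ?_⟩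
  obtain ⟨t, s, hts, hsx⟩ := hpc x hxs hx
  obtain ⟨htC, -, l, -, hl⟩ := (hO c t s).1 hts
  have htx : IsRestriction x l t := ⟨hl.isSeq_init, fun y hy => hsx y (hl.codeSubset y hy)⟩
  exact ⟨l, t, (hC.1 c t htC).isMu hx.1.1 htx (hsx _ hl.inCode), htx, htC⟩

end Partitions

section Composition

variable {M : Type u} [NumStructure M]

/-- The string `s` is contained in the composition of the string `g` with the string or partition
whose graph is `y`. -/
def CompExtends (g : M) (y : Set M) (s : M) : Prop :=
  ∀ i j, InCode s (pair i j) → ∃ b, pair i b ∈ y ∧ InCode g (pair b j)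

/-- The composition of `g` and `y` extends a string from the code `O` of an open set; every
partition that extends the composition is then in this open set. -/
def CompMeets (O : Set M) (g : M) (y : Set M) : Prop :=
  ∃ m s, pair m s ∈ O ∧ CompExtends g y s

theorem CompExtends.mono {g s : M} {y y' : Set M} (h : CompExtends g y s) (hy : y ⊆ y') :
    CompExtends g y' s :=
  fun i j hij => (h i j hij).imp fun _ hb => ⟨hy hb.1, hb.2⟩

theorem CompMeets.mono {O : Set M} {g : M} {y y' : Set M} (h : CompMeets O g y) (hy : y ⊆ y') :
    CompMeets O g y' := by
  obtain ⟨m, s, hms, hs⟩ := h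
  exact ⟨m, s, hms, hs.mono hy⟩

variable [RCA0Model M]

theorem compExtends_iff {g s : M} {y : Set M} : CompExtends g y s ↔ ∀ i, i < s → ∀ j, j < s →
    InCode s (pair i j) → ∃ b, b < g ∧ pair i b ∈ y ∧ InCode g (pair b j) :=
  ⟨fun h i _ j _ hij => (h i j hij).imp fun _ hb => ⟨hb.2.left_lt, hb⟩,
    fun h i j hij => (h i hij.left_lt j hij.right_lt hij).imp fun _ => And.right⟩

section Definability

instance (O y : Set M) [Fact (O ∈ sets)] [Fact (y ∈ sets)] :
    IsSigma fun e : ℕ → M => CompMeets O (e 0) y :=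
  (inferInstance : IsSigma fun e : ℕ → M => ∃ m s, pair m s ∈ O ∧ ∀ i, i < s → ∀ j, j < s →
    InCode s (pair i j) → ∃ b, b < e 0 ∧ pair i b ∈ y ∧ InCode (e 0) (pair b j)).congr fun e => by
      simp only [CompMeets, compExtends_iff]

instance (O y : Set M) [Fact (O ∈ sets)] [Fact (y ∈ sets)] (f : (ℕ → M) → M) [IsFn f] :
    IsSigma fun e => CompMeets O (f e) y :=
  IsSigma.comp₁ f (P := fun g => CompMeets O g y) inferInstance

instance (E : Set M) [Fact (E ∈ sets)] (f g h : (ℕ → M) → M) [IsFn f] [IsFn g] [IsFn h] :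
    IsSigma fun e => CompMeets (openSection E (f e)) (g e) {x | InCode (h e) x} := by
  refine IsSigma.comp₃ f g h (P := fun n g y => CompMeets (openSection E n) g {x | InCode y x}) ?_
  exact (inferInstance : IsSigma fun e : ℕ → M => ∃ m s, pair (e 0) (pair m s) ∈ E ∧
    ∀ i, i < s → ∀ j, j < s → InCode s (pair i j) → ∃ b, b < e 1 ∧ InCode (e 2) (pair i b) ∧
      InCode (e 1) (pair b j)).congr fun e => by
        simp only [CompMeets, compExtends_iff, openSection, Set.mem_ofPred_eq]

end Definability

theorem CompMeets.inOpen {k : ℕ} {O x y h : Set M} {g : M} (hm : CompMeets O g y)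
    (hO : IsOpenCode k O) (hg : IsPrefix g h)
    (hx : ∀ n b j, pair n b ∈ y → pair b j ∈ h → pair n j ∈ x) : InOpen O x := by
  obtain ⟨n, s, hns, hs⟩ := hm
  obtain ⟨l, hl⟩ := (hO.isFinPartition hns).1
  refine ⟨n, s, hns, hl.forall_inCode (P := (· ∈ x)) fun i j hij => ?_⟩
  obtain ⟨b, hb, hbj⟩ := hs i j hij
  exact hx i b j hb (hg _ hbj)

theorem IsOrderedSeq.exists_comp {k b g y l : M} (hg : IsOrderedSeq k g) (hgb : IsSeq g b)
    (hy : IsOrderedSeq b y) (hyl : IsSeq y l) :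
    ∃ t, IsOrderedSeq k t ∧
      ∀ i j, InCode t (pair i j) ↔ ∃ c, InCode y (pair i c) ∧ InCode g (pair c j) := by
  obtain ⟨t, ht, htR⟩ := exists_seq_of_forall_exists (l := l)
    (fun i j => ∃ c, InCode y (pair i c) ∧ InCode g (pair c j)) fun i hi => by
      obtain ⟨c, hc⟩ := hyl.exists_value hi
      obtain ⟨j, hj⟩ := hgb.exists_value (hy.value_lt hc)
      exact ⟨j, c, hc, hj⟩
  have hmem : ∀ i j, InCode t (pair i j) ↔ ∃ c, InCode y (pair i c) ∧ InCode g (pair c j) := by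
    refine fun i j => ⟨htR i j, fun ⟨c, hc, hcj⟩ => ?_⟩
    obtain ⟨j', hj'⟩ := ht.exists_value (hyl.lt_length hc)
    obtain ⟨c', hc', hcj'⟩ := htR i j' hj'
    rw [hyl.value_unique hc' hc] at hcj'
    rwa [hgb.value_unique hcj hcj']
  refine ⟨t, ⟨⟨l, ht⟩, fun n i hni => ?_, fun n i hni j hj => ?_, fun i hi => ?_⟩, hmem⟩
  · obtain ⟨c, -, hc⟩ := htR n i hni
    exact hg.value_lt hc
  · obtain ⟨c, hc, hci⟩ := htR n i hni
    obtain ⟨c', hc', hcj⟩ := hg.isOrdered c i hci j hj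
    obtain ⟨m, hm, hmc⟩ := hy.isOrdered n c hc c' hc'
    exact ⟨m, hm, (hmem m j).2 ⟨c', hmc, hcj⟩⟩
  · obtain ⟨c, hc⟩ := hg.exists_position i hi
    obtain ⟨n, hn⟩ := hy.exists_position c (hgb.lt_length hc)
    exact ⟨n, (hmem n i).2 ⟨c, hn, hc⟩⟩

end Composition

section Extensions

variable {M : Type u} [NumStructure M] [RCA0Model M] {b b' l m y z : M}

theorem IsOrderedSeq.value_le (hy : IsOrderedSeq b y) {n i : M} (hni : InCode y (pair n i)) :
    i ≤ n := by
  suffices ∀ n, n < y → InCode y (pair n i) → i ≤ n from this n hni.left_lt hni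
  refine sigma_induction (fun i => ∀ n, n < y → InCode y (pair n i) → i ≤ n)
    (fun _ _ _ => zero_le) (fun i ih n _ hn => ?_) i
  obtain ⟨m, hmn, hm⟩ := hy.isOrdered n _ hn i (lt_add_one i)
  exact Order.add_one_le_iff.2 ((ih m (hm : InCode y _).left_lt hm).trans_lt hmn)

theorem IsOrderedSeq.le_length (hy : IsOrderedSeq b y) (hl : IsSeq y l) : b ≤ l := by
  by_contra! hlb
  obtain ⟨n, hn⟩ := hy.exists_position l hlb
  exact (hl.lt_length hn).not_ge (hy.value_le hn)

theorem IsOrderedSeq.of_codeSubset (hy : IsOrderedSeq b y) (hl : IsSeq y l) (hz : IsSeq z m)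
    (hyz : CodeSubset y z) (hb : b ≤ b')
    (hnew : ∀ i c, l ≤ i → InCode z (pair i c) → c ≤ b ∧ c < b')
    (hpos : ∀ c, b ≤ c → c < b' → ∃ n, InCode z (pair n c)) : IsOrderedSeq b' z where
  exists_length := ⟨m, hz⟩
  value_lt i c hic := by
    rcases lt_or_ge i l with hi | hi
    · exact (hy.value_lt (hl.inCode_of_codeSubset hz hyz hi hic)).trans_le hb
    · exact (hnew i c hi hic).2
  isOrdered i c hic d hd := by
    rcases lt_or_ge i l with hi | hi
    · exact (hy.isOrdered i c (hl.inCode_of_codeSubset hz hyz hi hic) d hd).imp fun n hn =>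
        ⟨hn.1, hyz _ hn.2⟩
    · obtain ⟨n, hn⟩ := hy.exists_position d (hd.trans_le (hnew i c hi hic).1)
      exact ⟨n, (hl.lt_length hn).trans_le hi, hyz _ hn⟩
  exists_position c hc := by
    rcases lt_or_ge c b with hcb | hcb
    · exact (hy.exists_position c hcb).imp fun n => hyz _
    · exact hpos c hcb hc

theorem IsOrderedSeq.exists_isSnoc (hy : IsOrderedSeq b y) (hl : IsSeq y l) :
    ∃ z, IsSnoc y l b z ∧ IsOrderedSeq (b + 1) z := by
  obtain ⟨z, hz, hyz, hzb⟩ := hl.exists_extension (lt_add_one l).le (fun _ c => c = b)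
    fun _ _ _ => ⟨b, rfl⟩
  obtain ⟨c, hc⟩ := hz.exists_value (lt_add_one l)
  obtain rfl := hzb l c le_rfl hc
  refine ⟨z, ⟨hl, hz, hyz, hc⟩, hy.of_codeSubset hl hz hyz (lt_add_one c).le
    (fun i d hi hid => ?_) fun d hcd hd => ⟨l, ?_⟩⟩
  · obtain rfl := hzb i d hi hid
    exact ⟨le_rfl, lt_add_one d⟩
  · rwa [(Order.lt_add_one_iff.1 hd).antisymm hcd]

theorem exists_isOrderedSeq_zero : ∃ a : M, IsOrderedSeq 0 a := by
  obtain ⟨a, ha, -⟩ := exists_seq (fun _ => (0 : M)) 0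
  exact ⟨a, ⟨0, ha⟩, fun n i h => absurd (ha.lt_length h) not_lt_zero,
    fun n i h => absurd (ha.lt_length h) not_lt_zero, fun i hi => absurd hi not_lt_zero⟩

theorem IsOrderedSeq.exists_compExtends {g s : M} (hgb : IsSeq g b) (hy : IsOrderedSeq b y)
    (hs : IsSeq s m) (hsg : ∀ i j, InCode s (pair i j) → ∃ c, InCode g (pair c j))
    (hys : ∀ i j c, InCode y (pair i c) → InCode g (pair c j) → InCode s (pair i j)) :
    ∃ z, IsOrderedSeq b z ∧ CodeSubset y z ∧ CompExtends g {x | InCode z x} s := by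
  obtain ⟨l, hl⟩ := hy.exists_length
  have hyg : ∀ i c, InCode y (pair i c) → ∃ j, InCode g (pair c j) ∧ InCode s (pair i j) :=
    fun i c hic => (hgb.exists_value (hy.value_lt hic)).imp fun j hj => ⟨hj, hys i j c hic hj⟩
  have hlm : l ≤ m := by
    by_contra! hml
    obtain ⟨c, hc⟩ := hl.exists_value hml
    obtain ⟨j, -, hj⟩ := hyg m c hc
    exact (hs.lt_length hj).false
  obtain ⟨z, hz, hyz, hzR⟩ := hl.exists_extension hlm
    (fun i c => ∃ j, InCode s (pair i j) ∧ InCode g (pair c j)) fun i _ hi => by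
      obtain ⟨j, hj⟩ := hs.exists_value hi
      exact (hsg i j hj).imp fun c hc => ⟨j, hj, hc⟩
  have hzb : ∀ i c, l ≤ i → InCode z (pair i c) → c < b := fun i c hi hic => by
    obtain ⟨j, -, hj⟩ := hzR i c hi hic
    exact hgb.lt_length hj
  refine ⟨z, hy.of_codeSubset hl hz hyz le_rfl (fun i c hi hic => ⟨(hzb i c hi hic).le,
    hzb i c hi hic⟩) fun c hbc hcb => absurd hcb hbc.not_gt, hyz, fun i j hij => ?_⟩
  obtain ⟨c, hc⟩ := hz.exists_value (hs.lt_length hij)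
  obtain ⟨j', hj', hcj'⟩ : ∃ j', InCode s (pair i j') ∧ InCode g (pair c j') := by
    rcases lt_or_ge i l with hi | hi
    · exact (hyg i c (hl.inCode_of_codeSubset hz hyz hi hc)).imp fun _ => And.symm
    · exact hzR i c hi hc
  exact ⟨c, hc, hs.value_unique hj' hij ▸ hcj'⟩

theorem exists_extension_compMeets {k : ℕ} {O : Set M} (hO : IsOpenCode k O)
    (hd : IsDenseCode k O) {g : M} (hg : IsFinPartition k g) (hgb : IsSeq g b)
    (hy : IsOrderedSeq b y) :
    ∃ z, IsOrderedSeq b z ∧ CodeSubset y z ∧ CompMeets O g {x | InCode z x} := by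
  obtain ⟨l, hl⟩ := hy.exists_length
  obtain ⟨t, ht, hty⟩ := (isFinPartition_iff.1 hg).exists_comp hgb hy hl
  obtain ⟨m, s, hms, hst | hts⟩ := hd t (isFinPartition_iff.2 ht)
  · exact ⟨y, hy, fun _ h => h, m, s, hms, fun i j hij => (hty i j).1 (hst _ hij)⟩
  · obtain ⟨⟨l', hs⟩, hsk, -⟩ := hO.isFinPartition hms
    obtain ⟨z, hz, hyz, hzs⟩ := hy.exists_compExtends hgb hs
      (fun i j hij => hg.2.2.2 j (hsk i j hij))
        fun i j c hic hcj => hts _ ((hty i j).2 ⟨c, hic, hcj⟩)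
    exact ⟨z, hz, hyz, m, s, hms, hzs⟩

theorem exists_extension_forall_lt (Q : M → M → Prop) [hQ : IsSigma fun e => Q (e 0) (e 1)]
    (hmono : ∀ u y z, CodeSubset y z → Q u y → Q u z)
    (hext : ∀ u y, IsOrderedSeq b y → ∃ z, IsOrderedSeq b z ∧ CodeSubset y z ∧ Q u z)
    (hy : IsOrderedSeq b y) (t : M) :
    ∃ z, IsOrderedSeq b z ∧ CodeSubset y z ∧ ∀ u, u < t → Q u z := by
  have (f g : (ℕ → M) → M) [IsFn f] [IsFn g] : IsSigma fun e => Q (f e) (g e) := hQ.comp₂ f g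
  refine sigma_induction (fun t => ∃ z, IsOrderedSeq b z ∧ CodeSubset y z ∧ ∀ u, u < t → Q u z)
    ⟨y, hy, fun _ h => h, fun u hu => absurd hu not_lt_zero⟩ ?_ t
  rintro t ⟨z, hz, hyz, hzQ⟩
  obtain ⟨w, hw, hzw, hwQ⟩ := hext t z hz
  refine ⟨w, hw, fun x hx => hzw x (hyz x hx), fun u hu => ?_⟩
  rcases (Order.lt_add_one_iff.1 hu).lt_or_eq with hu | rfl
  · exact hmono u z w hzw (hzQ u hu)
  · exact hwQ

theorem IsFinPartition.lt_codeBound {k : ℕ} {g B : M} (hg : IsFinPartition k g) (hgb : IsSeq g b)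
    (hB : IsCodeBound (pair b (numeral M k)) B) : g < B := by
  obtain ⟨c, hcB, hc, hce⟩ := hB.exists_code (InCode g)
  suffices g = c from this ▸ hcB
  refine hgb.1.ext hc fun x => ?_
  rw [hce x, iff_and_self]
  exact hgb.forall_inCode (P := (· < pair b (numeral M k))) (fun i j hij =>
    pair_lt_pair_of_add_lt (add_lt_add (hgb.lt_length hij) (hg.2.1 i j hij))) x

end Extensions

section Generic

variable {M : Type u} [NumStructure M] {k : ℕ} {E : Set M}

/-- The composition of every string of length `b` in `(ω)^k_fin` with the string `y` meets the first
`b` open sets of the sequence coded by `E`. -/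
def CompMeetsAll (k : ℕ) (E : Set M) (b y : M) : Prop :=
  ∀ g, IsFinPartition k g → IsSeq g b → ∀ i, i < b → CompMeets (openSection E i) g {x | InCode y x}

variable [RCA0Model M]

instance [Fact (E ∈ sets)] (f g : (ℕ → M) → M) [IsFn f] [IsFn g] :
    IsSigma fun e => CompMeetsAll k E (f e) (g e) := by
  refine IsSigma.comp₂ f g (P := CompMeetsAll k E) ?_
  refine (inferInstance : IsSigma fun e : ℕ → M => ∃ B, IsCodeBound (pair (e 0) (numeral M k)) B ∧
    ∀ g, g < B → IsFinPartition k g → IsSeq g (e 0) → ∀ i, i < e 0 →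
      CompMeets (openSection E i) g {x | InCode (e 1) x}).congr fun e => ⟨fun h => ?_, ?_⟩
  · obtain ⟨B, hB⟩ := exists_isCodeBound (pair (e 0) (numeral M k))
    exact ⟨B, hB, fun g _ => h g⟩
  · rintro ⟨B, hB, h⟩ g hg hgb
    exact h g (hg.lt_codeBound hgb hB) hg hgb

variable (hEs : E ∈ sets) (hE : IsOpenSeqCode k E) (hd : ∀ n, IsDenseCode k (openSection E n))
include hEs hE hd

theorem exists_extension_compMeetsAll {b y : M} (hy : IsOrderedSeq b y) :
    ∃ z, IsOrderedSeq b z ∧ CodeSubset y z ∧ CompMeetsAll k E b z := by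
  have := Fact.mk hEs
  obtain ⟨B, hB⟩ := exists_isCodeBound (pair b (numeral M k))
  obtain ⟨z, hz, hyz, hzm⟩ := exists_extension_forall_lt (fun g z => IsFinPartition k g →
    IsSeq g b → ∀ i, i < b → CompMeets (openSection E i) g {x | InCode z x})
    (fun g y z hyz h hg hgb i hi => (h hg hgb i hi).mono hyz) (fun g y hy => by
      by_cases hg : IsFinPartition k g ∧ IsSeq g b
      · obtain ⟨z, hz, hyz, h⟩ := exists_extension_forall_lt
          (fun i z => CompMeets (openSection E i) g {x | InCode z x})
          (fun i y z hyz h => h.mono hyz)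
          (fun i y hy => exists_extension_compMeets ((isOpenSeqCode_iff.1 hE).2 i) (hd i) hg.1
            hg.2 hy) hy b
        exact ⟨z, hz, hyz, fun _ _ => h⟩
      · exact ⟨y, hy, fun _ h => h, fun h h' => absurd ⟨h, h'⟩ hg⟩) hy B
  exact ⟨z, hz, hyz, fun g hg hgb => hzm g (hg.lt_codeBound hgb hB) hg hgb⟩

theorem exists_generic_strings : ∃ F : M → M, IsFn (fun e => F (e 0)) ∧
    (∀ n, IsOrderedSeq n (F n)) ∧ (∀ n, CodeSubset (F n) (F (n + 1))) ∧
    ∀ n, CompMeetsAll k E (n + 1) (F (n + 1)) := by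
  have := Fact.mk hEs
  obtain ⟨a, ha⟩ := exists_isOrderedSeq_zero (M := M)
  obtain ⟨F, hF, hFo, hFR⟩ := exists_dependent_choice IsOrderedSeq
    (fun n y z => CodeSubset y z ∧ CompMeetsAll k E (n + (1 : M)) z) ha fun n y hy => by
      obtain ⟨l, hl⟩ := hy.exists_length
      obtain ⟨w, hyw, hw⟩ := hy.exists_isSnoc hl
      obtain ⟨z, hz, hwz, hzm⟩ := exists_extension_compMeetsAll hEs hE hd hw
      exact ⟨z, hz, fun x hx => hwz x (hyw.codeSubset x hx), hzm⟩
  exact ⟨F, hF, hFo, fun n => (hFR n).1, fun n => (hFR n).2⟩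

end Generic

section GenericPartition

variable {M : Type u} [NumStructure M]

/-- The composition of every string of length `n + 1` in `(ω)^k_fin` with the infinite partition `y`
meets the open sets number `0, …, n` of the sequence coded by `E`. -/
def IsGeneric (k : ℕ) (E y : Set M) : Prop :=
  ∀ n g, IsFinPartition k g → IsSeq g (n + 1) → ∀ i, i < n + 1 → CompMeets (openSection E i) g y

variable [RCA0Model M]

theorem codeSubset_of_le (F : M → M) [hF : IsFn fun e => F (e 0)]
    (hFs : ∀ n, CodeSubset (F n) (F (n + 1))) {n m : M} (hnm : n ≤ m) : CodeSubset (F n) (F m) := by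
  have (f : (ℕ → M) → M) [IsFn f] : IsFn fun e => F (f e) := IsFn.comp₁ f hF
  obtain ⟨d, rfl⟩ := exists_add_of_le hnm
  refine sigma_induction (fun d => CodeSubset (F n) (F (n + d)))
    (by rw [add_zero]; exact fun _ h => h) (fun d hd x hx => ?_) d
  rw [← add_assoc]
  exact hFs _ x (hd x hx)

theorem exists_limit_partition (F : M → M) [hF : IsFn fun e => F (e 0)]
    (hFo : ∀ n, IsOrderedSeq n (F n)) (hFs : ∀ n, CodeSubset (F n) (F (n + 1))) :
    ∃ y ∈ sets, IsInfPartition y ∧ ∀ n, IsPrefix (F n) y := by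
  have (f : (ℕ → M) → M) [IsFn f] : IsFn fun e => F (f e) := IsFn.comp₁ f hF
  obtain ⟨y, hys, hyf, hy⟩ := exists_graph (fun i j => ∃ n, InCode (F n) (pair i j)) fun i => by
    obtain ⟨l, hl⟩ := (hFo (i + 1)).exists_length
    obtain ⟨j, hj⟩ := hl.exists_value (Order.add_one_le_iff.1 ((hFo (i + 1)).le_length hl))
    refine ⟨j, ⟨i + 1, hj⟩, fun j' ⟨n, hn⟩ => ?_⟩
    obtain ⟨l', hl'⟩ := (hFo (max n (i + 1))).exists_length
    exact hl'.value_unique (codeSubset_of_le F hFs (le_max_left _ _) _ hn)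
      (codeSubset_of_le F hFs (le_max_right _ _) _ hj)
  refine ⟨y, hys, ⟨hyf, fun n i hni j hj => ?_, fun i => ?_⟩, fun n => ?_⟩
  · obtain ⟨s, hs⟩ := (hy n i).1 hni
    exact ((hFo s).isOrdered n i hs j hj).imp fun m hm => ⟨hm.1, (hy m j).2 ⟨s, hm.2⟩⟩
  · obtain ⟨n, hn⟩ := (hFo (i + 1)).exists_position i (lt_add_one i)
    exact ⟨n, (hy n i).2 ⟨i + 1, hn⟩⟩
  · obtain ⟨l, hl⟩ := (hFo n).exists_length
    exact hl.forall_inCode (P := (· ∈ y)) fun i j hij => (hy i j).2 ⟨n, hij⟩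

theorem exists_isGeneric {k : ℕ} {E : Set M} (hEs : E ∈ sets) (hE : IsOpenSeqCode k E)
    (hd : ∀ n, IsDenseCode k (openSection E n)) :
    ∃ y ∈ sets, IsInfPartition y ∧ IsGeneric k E y := by
  obtain ⟨F, hF, hFo, hFs, hFm⟩ := exists_generic_strings hEs hE hd
  obtain ⟨y, hys, hy, hFy⟩ := exists_limit_partition F hFo hFs
  exact ⟨y, hys, hy, fun n g hg hgn i hi =>
    (hFm n g hg hgn i hi).mono (hFy (n + 1))⟩

theorem IsGeneric.inOpen {k : ℕ} {E x y h : Set M} (hy : IsGeneric (k + 1) E y)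
    (hE : IsOpenSeqCode (k + 1) E) (hhs : h ∈ sets) (hh : IsPartition (k + 1) h)
    (hx : ∀ n b j, pair n b ∈ y → pair b j ∈ h → pair n j ∈ x) (i : M) :
    InOpen (openSection E i) x := by
  obtain ⟨m, hm⟩ := hh.2.2.2 (numeral M k) (lt_add_one _)
  obtain ⟨g, hg⟩ := exists_restriction hhs hh.1 (max m i + 1)
  have hgk := hh.isFinPartition_restriction hm (Order.lt_add_one_iff.2 (le_max_left m i)) hg
  have hmeets := hy _ g hgk hg.1 i (Order.lt_add_one_iff.2 (le_max_right m i))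
  exact hmeets.inOpen ((isOpenSeqCode_iff.1 hE).2 i) hg.2 hx

theorem IsGeneric.exists_isStringColoring {k ℓ : ℕ} {E y : Set M} {O : Fin ℓ → Set M}
    (hy : IsGeneric (k + 1) E y) (hys : y ∈ sets) (hOs : ∀ c, O c ∈ sets)
    (hE0 : openSection E 0 = ⋃ c, O c) : ∃ C : Fin ℓ → Set M, (∀ c, C c ∈ sets) ∧
      IsStringColoring k C ∧
      ∀ c, ∀ t ∈ C c, ∃ l g, IsSnoc t l (numeral M k) g ∧ CompMeets (O c) g y := by
  have := Fact.mk hys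
  have (c : Fin ℓ) := Fact.mk (hOs c)
  obtain ⟨C, hCs, hC, hCt⟩ := sigma_reduction (IsFinPartition k)
    (fun (c : Fin ℓ) t => ∃ l g, IsSnoc t l (numeral M k) g ∧ CompMeets (O c) g y) fun t ht => by
      obtain ⟨l, hl⟩ := ht.1
      obtain ⟨g, htg, hg⟩ := (isFinPartition_iff.1 ht).exists_isSnoc hl
      obtain ⟨m, s, hms, hs⟩ := hy l g (isFinPartition_iff.2 hg) htg.isSeq 0
        (Order.lt_add_one_iff.2 zero_le)
      obtain ⟨c, hc⟩ := Set.mem_iUnion.1 (hE0 ▸ hms : pair m s ∈ ⋃ c, O c)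
      exact ⟨c, l, g, htg, m, s, hc, hs⟩
  exact ⟨C, hCs, ⟨fun c t ht => (hC c t ht).1, hCt⟩, fun c t ht => (hC c t ht).2⟩

end GenericPartition

section Coarsenings

variable {M : Type u} [NumStructure M] [RCA0Model M] {k : ℕ} {x y q p : Set M}

theorem IsInfPartition.exists_comp (hys : y ∈ sets) (hqs : q ∈ sets) (hy : IsInfPartition y)
    (hq : IsInfPartition q) : ∃ p ∈ sets, IsInfPartition p ∧
      ∀ n a, pair n a ∈ p ↔ ∃ b, pair n b ∈ y ∧ pair b a ∈ q := by
  have := Fact.mk hys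
  have := Fact.mk hqs
  obtain ⟨p, hps, hpf, hp⟩ := exists_graph (fun n a => ∃ b, pair n b ∈ y ∧ pair b a ∈ q)
    fun n => by
      obtain ⟨b, hb⟩ := hy.1.exists_value n
      obtain ⟨a, ha⟩ := hq.1.exists_value b
      refine ⟨a, ⟨b, hb, ha⟩, fun a' ⟨b', hb', ha'⟩ => ?_⟩
      rw [hy.1.value_unique hb' hb] at ha'
      exact hq.1.value_unique ha' ha
  refine ⟨p, hps, ⟨hpf, fun n a hna c hc => ?_, fun a => ?_⟩, hp⟩
  · obtain ⟨b, hb, ha⟩ := (hp n a).1 hna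
    obtain ⟨b', hb', hc'⟩ := hq.2.1 b a ha c hc
    exact (hy.2.1 n b hb b' hb').imp fun m hm => ⟨hm.1, (hp m c).2 ⟨b', hm.2, hc'⟩⟩
  · obtain ⟨b, hb⟩ := hq.2.2 a
    exact (hy.2.2 b).imp fun n hn => (hp n a).2 ⟨b, hn, hb⟩

theorem IsMu.value_lt {m n b c : M} (hn : IsMu y b n) (hyo : IsOrdered y) (hmn : m < n)
    (hm : pair m c ∈ y) : c < b := by
  by_contra! hbc
  rcases hbc.lt_or_eq with hbc | rfl
  · obtain ⟨m', hm', hb⟩ := hyo m c hm b hbc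
    exact hn.2 m' (hm'.trans hmn) hb
  · exact hn.2 m hmn hm

theorem IsCoarsening.exists_factor (hys : y ∈ sets) (hxs : x ∈ sets) (hy : IsInfPartition y)
    (hx : IsCoarsening k y x) : ∃ h ∈ sets, IsPartition k h ∧
      ∀ n b j, pair n b ∈ y → (pair b j ∈ h ↔ pair n j ∈ x) := by
  have := Fact.mk hys
  have := Fact.mk hxs
  obtain ⟨⟨hxf, hxlt, hxo, hxsurj⟩, hxy⟩ := hx
  obtain ⟨h, hhs, hhf, hh⟩ := exists_graph (fun b j => ∃ n, pair n b ∈ y ∧ pair n j ∈ x)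
    fun b => by
      obtain ⟨n, hn⟩ := hy.2.2 b
      obtain ⟨j, hj⟩ := hxf.exists_value n
      exact ⟨j, ⟨n, hn, hj⟩, fun j' ⟨m, hm, hj'⟩ => hxf.value_unique (hxy m n b hm hn j' hj') hj⟩
  have hhx : ∀ n b j, pair n b ∈ y → (pair b j ∈ h ↔ pair n j ∈ x) := fun n b j hn =>
    (hh b j).trans ⟨fun ⟨m, hm, hmj⟩ => hxy m n b hm hn j hmj, fun hnj => ⟨n, hn, hnj⟩⟩
  refine ⟨h, hhs, ⟨hhf, fun b j hj => ?_, fun b i hi j hj => ?_, fun j hj => ?_⟩, hhx⟩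
  · obtain ⟨n, -, hn⟩ := (hh b j).1 hj
    exact hxlt n j hn
  · obtain ⟨n₀, hn₀⟩ := hy.2.2 b
    obtain ⟨n, hn⟩ := exists_least (fun n => pair n b ∈ y) hn₀
    obtain ⟨m, hm, hmj⟩ := hxo n i ((hhx n b i hn.1).1 hi) j hj
    obtain ⟨c, hc⟩ := hy.1.exists_value m
    exact ⟨c, IsMu.value_lt hn hy.2.1 hm hc, (hhx m c j hc).2 hmj⟩
  · obtain ⟨n, hn⟩ := hxsurj j hj
    exact (hy.1.exists_value n).imp fun b hb => (hhx n b j hb).2 hn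

theorem IsCoarsening.exists_factor_of_comp (hys : y ∈ sets) (hxs : x ∈ sets)
    (hy : IsInfPartition y) (hq : IsFun q)
    (hp : ∀ n a, pair n a ∈ p ↔ ∃ b, pair n b ∈ y ∧ pair b a ∈ q) (hx : IsCoarsening k p x) :
    ∃ h ∈ sets, IsCoarsening k q h ∧ ∀ n b j, pair n b ∈ y → pair b j ∈ h → pair n j ∈ x := by
  have hxy : IsCoarsening k y x := by
    refine ⟨hx.1, fun n m b hn hm => ?_⟩
    obtain ⟨a, ha⟩ := hq.exists_value b
    exact hx.2 n m a ((hp n a).2 ⟨b, hn, ha⟩) ((hp m a).2 ⟨b, hm, ha⟩)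
  obtain ⟨h, hhs, hh, hhx⟩ := hxy.exists_factor hys hxs hy
  refine ⟨h, hhs, ⟨hh, fun b b' a hb hb' j hj => ?_⟩, fun n b j hn => (hhx n b j hn).1⟩
  obtain ⟨n, hn⟩ := hy.2.2 b
  obtain ⟨m, hm⟩ := hy.2.2 b'
  rw [hhx m b' j hm]
  exact hx.2 n m a ((hp n a).2 ⟨b, hn, hb⟩) ((hp m a).2 ⟨b', hm, hb'⟩) j ((hhx n b j hn).1 hj)

theorem IsBaireColoring.exists_isOpenSeqCode {ℓ : ℕ} {O : Fin ℓ → Set M} {D : Set M}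
    (hOs : ∀ c, O c ∈ sets) (hDs : D ∈ sets) (h : IsBaireColoring k O D) :
    ∃ E ∈ sets, IsOpenSeqCode k E ∧ (∀ n, IsDenseCode k (openSection E n)) ∧
      openSection E 0 = ⋃ c, O c ∧ ∀ n : M, openSection E (n + 1) = openSection D n := by
  have (c : Fin ℓ) := Fact.mk (hOs c)
  have := Fact.mk hDs
  obtain ⟨hD, hDd, hO, hOd⟩ := h
  obtain ⟨E, hEs, hE, hsec⟩ := SecondOrderArith.exists_isOpenSeqCode (k := k)
    (fun n w => n = (0 : M) ∧ (∃ c, w ∈ O c) ∨ ∃ i, i ≤ n ∧ n = i + (1 : M) ∧ pair i w ∈ D) <| by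
      rintro n w (⟨-, c, hc⟩ | ⟨i, -, -, hi⟩)
      · exact hO c w hc
      · exact (isOpenSeqCode_iff.1 hD).2 i w hi
  have hE0 : openSection E 0 = ⋃ c, O c := by
    rw [hsec]
    ext w
    refine ⟨?_, fun hw => Or.inl ⟨rfl, Set.mem_iUnion.1 hw⟩⟩
    rintro (⟨-, hw⟩ | ⟨i, -, h0, -⟩)
    · exact Set.mem_iUnion.2 hw
    · exact absurd h0.symm (RCA0Model.isModel.succ_ne_zero i)
  have hEsucc (n : M) : openSection E (n + 1) = openSection D n := by
    rw [hsec]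
    ext w
    refine ⟨?_, fun hw => Or.inr ⟨n, (lt_add_one n).le, rfl, hw⟩⟩
    rintro (⟨h0, -⟩ | ⟨i, -, hi, hw⟩)
    · exact absurd h0 (RCA0Model.isModel.succ_ne_zero n)
    · rwa [← RCA0Model.isModel.succ_inj n i hi] at hw
  refine ⟨E, hEs, hE, fun n => ?_, hE0, hEsucc⟩
  rcases PAMinus.eq_zero_or_eq_add_one n with rfl | ⟨i, rfl⟩
  · rwa [hE0]
  · rw [hEsucc]
    exact hDd i

theorem CDRT.baireDRT {ℓ : ℕ} (h : CDRT (sets : Set (Set M)) (k + 1) ℓ) :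
    BaireDRT (sets : Set (Set M)) (k + 1) ℓ := by
  intro O D hOs hDs hcol
  obtain ⟨E, hEs, hE, hEd, hE0, hEsucc⟩ := hcol.exists_isOpenSeqCode hOs hDs
  obtain ⟨y, hys, hy, hgen⟩ := exists_isGeneric hEs hE hEd
  obtain ⟨C, hCs, hC, hCy⟩ := hgen.exists_isStringColoring hys hOs hE0
  obtain ⟨q, hqs, hq, c, hqc⟩ := h C hCs hC
  obtain ⟨p, hps, hp, hpe⟩ := hy.exists_comp hys hqs hq
  refine ⟨p, hps, hp, c, fun x hxs hx => ?_⟩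
  obtain ⟨f, hfs, hf, hfx⟩ := hx.exists_factor_of_comp hys hxs hy hq.1 hpe
  refine ⟨?_, fun n => hEsucc n ▸ hgen.inOpen hE hfs hf.1 hfx (n + 1)⟩
  obtain ⟨m, t, hm, htm, htC⟩ := hqc f hfs hf
  obtain ⟨l, g, htg, hg⟩ := hCy c t htC
  obtain rfl := htg.isSeq_init.length_unique htm.1
  exact hg.inOpen (hcol.2.2.1 c) (htg.isPrefix htm.2 hm.1) hfx

end Coarsenings

end SecondOrderArith

open SecondOrderArith in
theorem mainTheorem1 (k ℓ : ℕ) (hk : 2 ≤ k) (hℓ : 2 ≤ ℓ)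
    {M : Type*} [NumStructure M] (S : Set (Set M)) (hS : IsModelRCA0 S) :
    List.TFAE [BaireDRT S k ℓ, ODRT S k ℓ, CDRT S k ℓ] := by
  let _ : RCA0Model M := ⟨S, hS⟩
  obtain ⟨j, rfl⟩ : ∃ j, k = j + 1 := Nat.exists_eq_add_of_le' (one_le_two.trans hk)
  tfae_have 1 → 2 := BaireDRT.odrt
  tfae_have 2 → 3 := ODRT.cdrt
  tfae_have 3 → 1 := CDRT.baireDRT
  tfae_finish
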